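/- Let $\lambda>0$ and let $\mathbb A^{(\lambda)}(\mathbb D^3)$ be the Hilbert space of holomorphic functions on the polydisc $\mathbb D^3=\{\boldsymbol z\in\mathbb C^3: |z_1|,|z_2|,|z_3|<1\}$ with reproducing kernel $$K^{(\lambda)}(\boldsymbol z,\boldsymbol w)=\prod_{j=1}^3(1-z_j\bar w_j)^{-\lambda},$$ where the principal branch of the power is used. Let $\mathfrak S_3$ act by $(\sigma\cdot\boldsymbol z)_i=z_{\sigma^{-1}(i)}$. For a partition $\boldsymbol p$ of $3$ let $\chi_{\boldsymbol p}$ be the character of the irreducible representation of $\mathfrak S_3$ corresponding to $\boldsymbol p$ (so $(3)$ corresponds to the trivial, $(2,1)$ to the two-dimensional and $(1,1,1)$ to the sign representation), and put $$\mathbb P_{\boldsymbol p}f(\boldsymbol z)=\frac{\chi_{\boldsymbol p}(1)}{3!}\sum_{\sigma\in\mathfrak S_3}\overline{\chi_{\boldsymbol p}(\sigma)}\,f(\sigma^{-1}\cdot\boldsymbol z),\qquad f\in\mathbb A^{(\lambda)}(\mathbb D^3).$$ Each $\mathbb P_{\boldsymbol p}\big(\mathbb A^{(\lambda)}(\mathbb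 D^3)\big)$ is a Hilbert module over the ring $\mathbb C[\boldsymbol z]^{\mathfrak S_3}$ of symmetric polynomials, with pointwise multiplication as the action. Two Hilbert modules $M,N$ over $\mathbb C[\boldsymbol z]^{\mathfrak S_3}$ are called (unitarily) equivalent if there is a unitary operator $U:M\to N$ with $U(s\cdot f)=s\cdot Uf$ for all $s\in\mathbb C[\boldsymbol z]^{\mathfrak S_3}$ and $f\in M$. Then, in the orthogonal decomposition $$\mathbb A^{(\lambda)}(\mathbb D^3)=\mathbb P_{(3)}\big(\mathbb A^{(\lambda)}(\mathbb D^3)\big)\oplus\mathbb P_{(2,1)}\big(\mathbb A^{(\lambda)}(\mathbb D^3)\big)\oplus\mathbb P_{(1,1,1)}\big(\mathbb A^{(\lambda)}(\mathbb D^3)\big),$$ no two of the three summands on the right-hand side are equivalent as Hilbert modules over $\mathbb C[\boldsymbol z]^{\mathfrak S_3}$. -/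

import Mathlib

open ComplexConjugate

noncomputable section

namespace Bergman

/-! ### Scalar positive definite kernels -/

/-- Positive (semi)definiteness of a scalar kernel: all finite sums
`∑ x, ∑ y, conj (a x) * a y * k x y` have nonnegative real part, and `k` is Hermitian. -/
def PosKernel {X : Type*} (k : X → X → ℂ) : Prop :=
  (∀ x y, conj (k y x) = k x y) ∧
    ∀ (s : Finset X) (a : X → ℂ), 0 ≤ (∑ x ∈ s, ∑ y ∈ s, conj (a x) * a y * k x y).re

theorem PosKernel.one {X : Type*} : PosKernel (fun _ _ : X => (1 : ℂ)) := by
  refine ⟨by simp, fun s a => ?_⟩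
  have h : ∑ x ∈ s, ∑ y ∈ s, conj (a x) * a y * 1 = ((‖∑ x ∈ s, a x‖ ^ 2 : ℝ) : ℂ) := by
    simp_rw [mul_one, ← Finset.mul_sum, ← Finset.sum_mul, ← map_sum]
    rw [Complex.conj_mul']
    norm_cast
  rw [h, Complex.ofReal_re]
  positivity

/-- A function of one complex variable given on the unit disc by a power series with nonnegative
coefficients. -/
def PosCoeff (φ : ℂ → ℂ) : Prop :=
  ∃ c : ℕ → ℝ, (∀ j, 0 ≤ c j) ∧ ∀ t : ℂ, ‖t‖ < 1 → HasSum (fun j => (c j : ℂ) * t ^ j) (φ t)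

theorem PosKernel.mul_posCoeff {X : Type*} {k : X → X → ℂ} (hk : PosKernel k) {φ : ℂ → ℂ}
    (hφ : PosCoeff φ) (g : X → ℂ) (hg : ∀ x, ‖g x‖ < 1) :
    PosKernel (fun x y => φ (g x * conj (g y)) * k x y) := by
  obtain ⟨c, hc, hs⟩ := hφ
  have hlt : ∀ x y, ‖g x * conj (g y)‖ < 1 := fun x y => by
    rw [norm_mul, RCLike.norm_conj]
    exact mul_lt_one_of_nonneg_of_lt_one_left (norm_nonneg _) (hg x) (hg y).le
  refine ⟨fun x y => ?_, fun s a => ?_⟩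
  · rw [map_mul, hk.1 x y]
    congr 1
    have h1 := (hs _ (hlt y x)).map (starRingEnd ℂ) Complex.continuous_conj
    refine h1.unique ?_
    convert hs _ (hlt x y) using 2 with j
    simp [mul_comm]
  · have h1 : HasSum (fun j => ∑ x ∈ s, ∑ y ∈ s,
        conj (a x) * a y * ((c j : ℂ) * (g x * conj (g y)) ^ j * k x y))
        (∑ x ∈ s, ∑ y ∈ s, conj (a x) * a y * (φ (g x * conj (g y)) * k x y)) :=
      hasSum_sum fun x _ => hasSum_sum fun y _ =>
        ((hs _ (hlt x y)).mul_right (k x y)).mul_left (conj (a x) * a y)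
    refine (Complex.hasSum_re h1).nonneg fun j => ?_
    have h2 : ∑ x ∈ s, ∑ y ∈ s,
        conj (a x) * a y * ((c j : ℂ) * (g x * conj (g y)) ^ j * k x y) =
        (c j : ℂ) * ∑ x ∈ s, ∑ y ∈ s,
          conj (conj (g x) ^ j * a x) * (conj (g y) ^ j * a y) * k x y := by
      simp_rw [Finset.mul_sum]
      refine Finset.sum_congr rfl fun x _ => Finset.sum_congr rfl fun y _ => ?_
      simp only [map_mul, map_pow, Complex.conj_conj, mul_pow]
      ring
    rw [h2, Complex.re_ofReal_mul]
    exact mul_nonneg (hc j) (hk.2 s _)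

theorem PosKernel.prod {X ι : Type*} (s : Finset ι) (φ : ι → ℂ → ℂ)
    (hφ : ∀ i, PosCoeff (φ i)) (g : X → ι → ℂ) (hg : ∀ x i, ‖g x i‖ < 1) :
    PosKernel (fun x y => ∏ i ∈ s, φ i (g x i * conj (g y i))) := by
  classical
  induction s using Finset.induction_on with
  | empty => simpa using PosKernel.one
  | insert i s hi ih =>
    simp_rw [Finset.prod_insert hi]
    exact ih.mul_posCoeff (hφ i) (fun x => g x i) (fun x => hg x i)

/-- The coefficients `(r)_j / j!` of the power series of `(1 - t) ^ (-r)`. -/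
def binomCoeff (r : ℝ) : ℕ → ℝ
  | 0 => 1
  | j + 1 => binomCoeff r j * (r + j) / (j + 1)

theorem binomCoeff_nonneg {r : ℝ} (hr : 0 < r) : ∀ j, 0 ≤ binomCoeff r j
  | 0 => zero_le_one
  | j + 1 => by
    have := binomCoeff_nonneg hr j
    rw [binomCoeff]
    positivity

theorem binomCoeff_eq (r : ℝ) (j : ℕ) :
    (binomCoeff r j : ℂ) = Ring.choose ((r : ℂ) + j - 1) j := by
  rw [← Ring.multichoose_eq]
  have key : ∀ j : ℕ, (j.factorial : ℂ) * (binomCoeff r j : ℂ) =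
      (ascPochhammer ℂ j).eval (r : ℂ) := by
    intro j
    induction j with
    | zero => simp [binomCoeff]
    | succ j ih =>
      rw [ascPochhammer_succ_eval, ← ih, binomCoeff, Nat.factorial_succ]
      have : (j : ℂ) + 1 ≠ 0 := by exact_mod_cast Nat.succ_ne_zero j
      push_cast
      field_simp
  have h := Ring.factorial_nsmul_multichoose_eq_ascPochhammer (r : ℂ) j
  rw [Polynomial.ascPochhammer_smeval_eq_eval, ← key j, nsmul_eq_mul] at h
  exact (mul_left_cancel₀ (by exact_mod_cast j.factorial_ne_zero) h).symm

theorem hasSum_one_sub_cpow (r : ℝ) {t : ℂ} (ht : ‖t‖ < 1) :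
    HasSum (fun j => (binomCoeff r j : ℂ) * t ^ j) ((1 - t) ^ (-(r : ℂ))) := by
  have h := (Complex.one_div_one_sub_cpow_hasFPowerSeriesOnBall_zero (r : ℂ)).hasSum
    (y := t) (by simpa [enorm_eq_nnnorm, ← NNReal.coe_lt_coe] using ht)
  simp only [FormalMultilinearSeries.ofScalars_apply_eq, zero_add, smul_eq_mul] at h
  rw [Complex.cpow_neg, ← one_div]
  simpa only [binomCoeff_eq] using h

theorem posCoeff_one_sub_cpow {r : ℝ} (hr : 0 < r) :
    PosCoeff (fun t => (1 - t) ^ (-(r : ℂ))) :=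
  ⟨binomCoeff r, binomCoeff_nonneg hr, fun _ ht => hasSum_one_sub_cpow r ht⟩

theorem posCoeff_sub_mul {r : ℝ} (hr : 0 < r) :
    PosCoeff (fun t => (((1 + 1 / r : ℝ) : ℂ) - t) * (1 - t) ^ (-(r : ℂ))) := by
  refine ⟨fun j => (1 + 1 / r) * binomCoeff r j - (if j = 0 then 0 else binomCoeff r (j - 1)),
    fun j => ?_, fun t ht => ?_⟩
  · cases j with
    | zero => simp [binomCoeff]; positivity
    | succ j =>
      have h0 := binomCoeff_nonneg hr j
      have h1 : (1 + 1 / r) * binomCoeff r (j + 1) - binomCoeff r j =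
          binomCoeff r j * (r + j / r) / (j + 1) := by
        rw [binomCoeff]
        field_simp
        ring
      simp only [Nat.add_eq_zero_iff, one_ne_zero, and_false, if_false, Nat.add_sub_cancel]
      rw [h1]
      positivity
  · have h := hasSum_one_sub_cpow r ht
    have h2 : HasSum (fun j => ((if j = 0 then 0 else binomCoeff r (j - 1) : ℝ) : ℂ) * t ^ j)
        (t * (1 - t) ^ (-(r : ℂ))) := by
      rw [← hasSum_nat_add_iff' 1]
      simp only [Finset.range_one, Finset.sum_singleton, if_true, Complex.ofReal_zero, zero_mul,
        sub_zero, Nat.add_eq_zero_iff, one_ne_zero, and_false, if_false, Nat.add_sub_cancel]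
      refine (h.mul_left t).congr_fun fun j => ?_
      rw [pow_succ]
      ring
    have h3 := (h.mul_left (((1 + 1 / r : ℝ) : ℂ))).sub h2
    rw [← sub_mul] at h3
    refine h3.congr_fun fun j => ?_
    rw [Complex.ofReal_sub, Complex.ofReal_mul]
    ring

/-! ### Weighted composition operators on a reproducing kernel Hilbert space -/

theorem exists_weightedComp {X H : Type*} [NormedAddCommGroup H] [InnerProductSpace ℂ H]
    [CompleteSpace H] [RKHS ℂ H X ℂ] (φ : X → ℂ) (τ : X → X) (C : ℝ)
    (hpos : PosKernel fun x y => (C : ℂ) * RKHS.kernel H x y 1 -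
      φ x * conj (φ y) * RKHS.kernel H (τ x) (τ y) 1) :
    ∃ T : H →L[ℂ] H, ∀ f x, T f x = φ x * f (τ x) := by
  classical
  have hker : ∀ x y, inner ℂ (RKHS.kerFun H x 1) (RKHS.kerFun H y 1) =
      RKHS.kernel H x y 1 := fun x y => by
    rw [RKHS.kerFun_inner, RKHS.kerFun_apply]
    simp
  let L : (X →₀ ℂ) →ₗ[ℂ] H := Finsupp.linearCombination ℂ fun x => RKHS.kerFun H x 1
  let L' : (X →₀ ℂ) →ₗ[ℂ] H :=
    Finsupp.linearCombination ℂ fun x => conj (φ x) • RKHS.kerFun H (τ x) 1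
  have hdense : DenseRange L := by
    have h := RKHS.kerFun_dense (𝕜 := ℂ) H
    have h' : Submodule.span ℂ {RKHS.kerFun H x v | (x : X) (v : ℂ)} ≤ LinearMap.range L := by
      rw [Submodule.span_le]
      rintro _ ⟨x, v, rfl⟩
      refine ⟨Finsupp.single x v, ?_⟩
      simp only [L, Finsupp.linearCombination_single]
      rw [← map_smul]
      simp
    have h3 : (LinearMap.range L).topologicalClosure = ⊤ :=
      top_le_iff.1 (h ▸ Submodule.topologicalClosure_mono h')
    intro f
    have : f ∈ (LinearMap.range L).topologicalClosure := h3 ▸ Submodule.mem_top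
    rw [← SetLike.mem_coe, Submodule.topologicalClosure_coe] at this
    simpa only [LinearMap.coe_range] using this
  have hsq : ∀ (v : X → H) (a : X →₀ ℂ), ‖Finsupp.linearCombination ℂ v a‖ ^ 2 =
      (∑ x ∈ a.support, ∑ y ∈ a.support, conj (a x) * a y * inner ℂ (v x) (v y)).re := by
    intro v a
    rw [← inner_self_eq_norm_sq (𝕜 := ℂ), Finsupp.linearCombination_apply, Finsupp.sum,
      sum_inner]
    simp_rw [inner_sum, inner_smul_left, inner_smul_right, ← mul_assoc]
    rfl
  have hbound : ∀ a, ‖L' a‖ ≤ √C * ‖L a‖ := by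
    intro a
    have h1 : ‖L' a‖ ^ 2 ≤ C * ‖L a‖ ^ 2 := by
      have h2 := hpos.2 a.support a
      rw [hsq, hsq, ← Complex.re_ofReal_mul, ← sub_nonneg, ← Complex.sub_re]
      refine h2.trans_eq ?_
      congr 1
      rw [Finset.mul_sum, ← Finset.sum_sub_distrib]
      refine Finset.sum_congr rfl fun x _ => ?_
      rw [Finset.mul_sum, ← Finset.sum_sub_distrib]
      refine Finset.sum_congr rfl fun y _ => ?_
      rw [inner_smul_left, inner_smul_right, hker, hker, Complex.conj_conj]
      ring
    by_cases hC : 0 ≤ C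
    · refine le_of_sq_le_sq ?_ (by positivity)
      rwa [mul_pow, Real.sq_sqrt hC]
    · have h3 : ‖L' a‖ ^ 2 ≤ 0 := h1.trans
        (mul_nonpos_of_nonpos_of_nonneg (not_le.1 hC).le (sq_nonneg _))
      have h4 : ‖L' a‖ = 0 := by nlinarith [norm_nonneg (L' a)]
      rw [h4]
      positivity
  let S : H →L[ℂ] H := L'.extendOfNorm L
  have hS : ∀ x, S (RKHS.kerFun H x 1) = conj (φ x) • RKHS.kerFun H (τ x) 1 := by
    intro x
    have h := LinearMap.extendOfNorm_eq hdense ⟨_, hbound⟩ (Finsupp.single x 1)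
    simpa [L, L', S] using h
  refine ⟨ContinuousLinearMap.adjoint S, fun f x => ?_⟩
  have h1 : ∀ (g : H) (y : X), g y = inner ℂ (RKHS.kerFun H y 1) g := fun g y => by
    rw [RKHS.kerFun_inner]
    simp
  rw [h1, ContinuousLinearMap.adjoint_inner_right, hS, inner_smul_left, Complex.conj_conj, ← h1]

/-! ### The polydisc and its weighted Bergman spaces -/

/-- The open unit polydisc in `ℂⁿ`. -/
abbrev Polydisc (n : ℕ) : Type := {z : Fin n → ℂ // ∀ i, ‖z i‖ < 1}

/-- The permutation action `(σ • z) i = z (σ⁻¹ i)` on the polydisc. -/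
def permPoint {n : ℕ} (σ : Equiv.Perm (Fin n)) (z : Polydisc n) : Polydisc n :=
  ⟨fun i => z.1 (σ⁻¹ i), fun i => z.2 (σ⁻¹ i)⟩

/-- The kernel `K(z, w) = ∏ j, (1 - z j * conj (w j)) ^ (-lam)`. Since `1 - z j * conj (w j)` has
positive real part, the principal branch of the power is the holomorphic one. -/
def kernelFun (n : ℕ) (lam : ℝ) (z w : Polydisc n) : ℂ :=
  ∏ j, (1 - z.1 j * conj (w.1 j)) ^ (-(lam : ℂ))

/-- The kernel as a matrix of operators on the one-dimensional space `ℂ`. -/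
def kernelMatrix (n : ℕ) (lam : ℝ) : Matrix (Polydisc n) (Polydisc n) (ℂ →L[ℂ] ℂ) :=
  .of fun z w => kernelFun n lam z w • ContinuousLinearMap.id ℂ ℂ

theorem posKernel_kernelFun (n : ℕ) {lam : ℝ} (h : 0 < lam) : PosKernel (kernelFun n lam) :=
  PosKernel.prod Finset.univ (fun _ t => (1 - t) ^ (-(lam : ℂ)))
    (fun _ => posCoeff_one_sub_cpow h) (fun z : Polydisc n => z.1) (fun z => z.2)

instance kernelMatrix_posSemidef (n : ℕ) (lam : ℝ) [h : Fact (0 < lam)] :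
    Fact (kernelMatrix n lam).PosSemidef := by
  have hk := posKernel_kernelFun n h.out
  refine ⟨((RKHS.posSemidef_tfae (K := kernelMatrix n lam)).out 0 2 rfl rfl).2
    ⟨?_, fun vv => ?_⟩⟩
  · ext z w
    simp only [kernelMatrix, Matrix.conjTranspose_apply, Matrix.of_apply, star_smul]
    rw [← hk.1 z w]
    rw [show star (ContinuousLinearMap.id ℂ ℂ) = ContinuousLinearMap.id ℂ ℂ from star_one _]
    simp
  · refine (hk.2 vv.support vv).trans_eq ?_
    simp only [Finsupp.sum, RCLike.re_eq_complex_re]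
    congr 1
    refine Finset.sum_congr rfl fun x _ => Finset.sum_congr rfl fun y _ => ?_
    simp only [kernelMatrix, Matrix.of_apply, smul_apply,
      ContinuousLinearMap.id_apply, smul_eq_mul, RCLike.inner_apply, map_mul]
    rw [hk.1 x y]
    ring

/-- The weighted Bergman space `A^(lam)(Dⁿ)`: the Hilbert space of functions on the polydisc with
reproducing kernel `K(z, w) = ∏ j, (1 - z j * conj (w j)) ^ (-lam)`, for `lam > 0`. -/
def Space (n : ℕ) (lam : ℝ) [Fact (0 < lam)] : Type := RKHS.OfKernel (kernelMatrix n lam)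

variable {n : ℕ} {lam : ℝ} [Fact (0 < lam)]

instance : NormedAddCommGroup (Space n lam) :=
  inferInstanceAs (NormedAddCommGroup (RKHS.OfKernel (kernelMatrix n lam)))

instance : InnerProductSpace ℂ (Space n lam) :=
  inferInstanceAs (InnerProductSpace ℂ (RKHS.OfKernel (kernelMatrix n lam)))

instance : CompleteSpace (Space n lam) :=
  inferInstanceAs (CompleteSpace (RKHS.OfKernel (kernelMatrix n lam)))

instance : RKHS ℂ (Space n lam) (Polydisc n) ℂ :=
  inferInstanceAs (RKHS ℂ (RKHS.OfKernel (kernelMatrix n lam)) (Polydisc n) ℂ)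

theorem kernel_space (z w : Polydisc n) (c : ℂ) :
    RKHS.kernel (Space n lam) z w c = kernelFun n lam z w * c := by
  have h : RKHS.kernel (Space n lam) = kernelMatrix n lam :=
    RKHS.OfKernel.kernel_ofKernel (K := kernelMatrix n lam)
  rw [h]
  simp [kernelMatrix]

/-! ### Multiplication by polynomials -/

theorem exists_mulCoord (i : Fin n) :
    ∃ T : Space n lam →L[ℂ] Space n lam, ∀ f z, T f z = z.1 i * f z := by
  classical
  have hl : 0 < lam := Fact.out
  refine exists_weightedComp (fun z : Polydisc n => z.1 i) id (1 + 1 / lam) ?_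
  have h := PosKernel.prod (X := Polydisc n) Finset.univ
    (Function.update (fun _ t => (1 - t) ^ (-(lam : ℂ))) i
      (fun t => (((1 + 1 / lam : ℝ) : ℂ) - t) * (1 - t) ^ (-(lam : ℂ))))
    (fun j => by
      by_cases hj : j = i
      · subst hj
        simpa using posCoeff_sub_mul hl
      · simpa [hj] using posCoeff_one_sub_cpow hl)
    (fun z => z.1) (fun z => z.2)
  convert h using 3 with z w
  rw [kernel_space, id, id, kernel_space, mul_one, kernelFun,
    ← Finset.mul_prod_erase _ _ (Finset.mem_univ i),
    ← Finset.mul_prod_erase _ _ (Finset.mem_univ i), Function.update_self]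
  have hP : ∏ j ∈ Finset.univ.erase i, Function.update (fun _ t => (1 - t) ^ (-(lam : ℂ))) i
      (fun t => (((1 + 1 / lam : ℝ) : ℂ) - t) * (1 - t) ^ (-(lam : ℂ))) j
        (z.1 j * conj (w.1 j)) =
      ∏ j ∈ Finset.univ.erase i, (1 - z.1 j * conj (w.1 j)) ^ (-(lam : ℂ)) :=
    Finset.prod_congr rfl fun j hj => by
      rw [Function.update_of_ne (Finset.ne_of_mem_erase hj)]
  rw [hP]
  ring

theorem exists_mulPoly (p : MvPolynomial (Fin n) ℂ) :
    ∃ T : Space n lam →L[ℂ] Space n lam, ∀ f z, T f z = MvPolynomial.eval z.1 p * f z := by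
  induction p using MvPolynomial.induction_on with
  | C a => exact ⟨a • ContinuousLinearMap.id ℂ _, fun f z => by simp⟩
  | add p q hp hq =>
    obtain ⟨S, hS⟩ := hp
    obtain ⟨T, hT⟩ := hq
    exact ⟨S + T, fun f z => by simp [hS, hT, add_mul]⟩
  | mul_X p i hp =>
    obtain ⟨S, hS⟩ := hp
    obtain ⟨T, hT⟩ := exists_mulCoord (n := n) (lam := lam) i
    exact ⟨S ∘L T, fun f z => by simp [hS, hT, mul_assoc]⟩

/-- The bounded operator of pointwise multiplication by the polynomial `p`. -/
def mulOp (p : MvPolynomial (Fin n) ℂ) : Space n lam →L[ℂ] Space n lam :=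
  Classical.choose (exists_mulPoly p)

theorem mulOp_apply (p : MvPolynomial (Fin n) ℂ) (f : Space n lam) (z : Polydisc n) :
    mulOp p f z = MvPolynomial.eval z.1 p * f z :=
  Classical.choose_spec (exists_mulPoly p) f z

/-- The Hilbert module structure of the weighted Bergman space over `ℂ[z]`: the algebra
homomorphism sending a polynomial `p` to the bounded operator of pointwise multiplication
by `p`. -/
def mulPoly : MvPolynomial (Fin n) ℂ →ₐ[ℂ] (Space n lam →L[ℂ] Space n lam) where
  toFun := mulOp
  map_one' := by
    ext f z
    simp [mulOp_apply]
  map_mul' p q := by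
    ext f z
    simp [mulOp_apply, mul_assoc]
  map_zero' := by
    ext f z
    simp [mulOp_apply]
  map_add' p q := by
    ext f z
    simp [mulOp_apply, add_mul]
  commutes' c := by
    ext f z
    simp [mulOp_apply, Algebra.algebraMap_eq_smul_one]

theorem mulPoly_apply (p : MvPolynomial (Fin n) ℂ) (f : Space n lam) (z : Polydisc n) :
    mulPoly p f z = MvPolynomial.eval z.1 p * f z :=
  mulOp_apply p f z

/-! ### The action of the symmetric group -/

theorem exists_permOp (σ : Equiv.Perm (Fin n)) :
    ∃ T : Space n lam →L[ℂ] Space n lam, ∀ f z, T f z = f (permPoint σ⁻¹ z) := by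
  obtain ⟨T, hT⟩ := exists_weightedComp (H := Space n lam) (fun _ => 1) (permPoint σ⁻¹) 1 (by
    have h0 : ∀ z w : Polydisc n,
        kernelFun n lam (permPoint σ⁻¹ z) (permPoint σ⁻¹ w) = kernelFun n lam z w := fun z w =>
      Equiv.prod_comp (σ⁻¹)⁻¹ fun j => (1 - z.1 j * conj (w.1 j)) ^ (-(lam : ℂ))
    simp only [kernel_space, h0]
    exact ⟨by simp, by simp⟩)
  exact ⟨T, fun f z => by rw [hT, one_mul]⟩

/-- The operator `R_σ f = f ∘ σ⁻¹` on the weighted Bergman space. -/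
def permOp (σ : Equiv.Perm (Fin n)) : Space n lam →L[ℂ] Space n lam :=
  Classical.choose (exists_permOp σ)

theorem permOp_apply (σ : Equiv.Perm (Fin n)) (f : Space n lam) (z : Polydisc n) :
    permOp σ f z = f (permPoint σ⁻¹ z) :=
  Classical.choose_spec (exists_permOp σ) f z

/-! ### Irreducible characters of the symmetric group -/

/-- The boxes `(row, column)` of the Young diagram of the partition `p`, whose rows have weakly
decreasing lengths, listed row by row from left to right. -/
def boxes (p : n.Partition) : List (ℕ × ℕ) :=
  (p.parts.sort (· ≥ ·)).zipIdx.flatMap fun a => (List.range a.1).map fun c => (a.2, c)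

/-- The box containing the number `k` in the standard filling of the Young diagram of `p`. -/
def box (p : n.Partition) (k : Fin n) : ℕ × ℕ := (boxes p).getD k (0, 0)

open Classical in
/-- The Young symmetrizer of `p`: the sum over the row stabilizer times the signed sum over the
column stabilizer of the standard filling, in the group algebra of the symmetric group. -/
def youngSymmetrizer (p : n.Partition) : MonoidAlgebra ℂ (Equiv.Perm (Fin n)) :=
  (∑ σ : Equiv.Perm (Fin n) with ∀ k, (box p (σ k)).1 = (box p k).1,
      MonoidAlgebra.of ℂ _ σ) *
    ∑ σ : Equiv.Perm (Fin n) with ∀ k, (box p (σ k)).2 = (box p k).2,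
      ((Equiv.Perm.sign σ : ℤ) : ℂ) • MonoidAlgebra.of ℂ _ σ

/-- The irreducible representation of the symmetric group attached to `p`: the left ideal of the
group algebra generated by the Young symmetrizer. -/
def irrep (p : n.Partition) :
    Submodule (MonoidAlgebra ℂ (Equiv.Perm (Fin n))) (MonoidAlgebra ℂ (Equiv.Perm (Fin n))) :=
  Submodule.span _ {youngSymmetrizer p}

/-- The character of the irreducible representation attached to `p`. -/
def chi (p : n.Partition) (σ : Equiv.Perm (Fin n)) : ℂ :=
  LinearMap.trace ℂ (irrep p)
    (Algebra.lsmul ℂ ℂ (irrep p) (MonoidAlgebra.of ℂ (Equiv.Perm (Fin n)) σ))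

/-! ### The isotypic summands as Hilbert modules over the symmetric polynomials -/

/-- The operator `P_p f = (χ_p(1) / n!) ∑ σ, conj (χ_p σ) (f ∘ σ⁻¹)`. -/
def proj (lam : ℝ) [Fact (0 < lam)] (p : n.Partition) : Space n lam →L[ℂ] Space n lam :=
  (chi p 1 / (n.factorial : ℂ)) • ∑ σ : Equiv.Perm (Fin n), conj (chi p σ) • permOp σ

/-- The summand `P_p (A^(lam)(Dⁿ))`, with the inner product inherited from `A^(lam)(Dⁿ)`. -/
def summand (lam : ℝ) [Fact (0 < lam)] (p : n.Partition) : Submodule ℂ (Space n lam) :=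
  LinearMap.range (proj lam p).toLinearMap

theorem mulPoly_permOp {s : MvPolynomial (Fin n) ℂ} (hs : s.IsSymmetric)
    (σ : Equiv.Perm (Fin n)) (f : Space n lam) :
    mulPoly s (permOp σ f) = permOp σ (mulPoly s f) := by
  ext z
  rw [mulPoly_apply, permOp_apply, permOp_apply, mulPoly_apply]
  congr 1
  have h : (permPoint σ⁻¹ z).1 = z.1 ∘ σ := by
    ext i
    simp [permPoint]
  rw [h, ← MvPolynomial.eval_rename, hs σ]

theorem mulPoly_mem_summand {s : MvPolynomial (Fin n) ℂ} (hs : s.IsSymmetric) {p : n.Partition}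
    {f : Space n lam} (hf : f ∈ summand lam p) : mulPoly s f ∈ summand lam p := by
  obtain ⟨g, rfl⟩ := hf
  refine ⟨mulPoly s g, ?_⟩
  simp [proj, mulPoly_permOp hs]

/-- The module structure of `P_p (A^(lam)(Dⁿ))` over the ring of symmetric polynomials, given by
pointwise multiplication. -/
instance (p : n.Partition) : Module (MvPolynomial.symmetricSubalgebra (Fin n) ℂ)
    (summand lam p) where
  smul s f := ⟨mulPoly (s : MvPolynomial (Fin n) ℂ) (f : Space n lam),
    mulPoly_mem_summand s.2 f.2⟩
  one_smul f := Subtype.ext (by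
    change mulPoly (1 : MvPolynomial (Fin n) ℂ) (f : Space n lam) = f
    simp)
  mul_smul s t f := Subtype.ext (by
    change mulPoly (s.1 * t.1) f.1 = mulPoly s.1 (mulPoly t.1 f.1)
    simp)
  smul_zero s := Subtype.ext (map_zero (mulPoly s.1))
  smul_add s f g := Subtype.ext (map_add (mulPoly s.1) f.1 g.1)
  add_smul s t f := Subtype.ext (by
    change mulPoly (s.1 + t.1) f.1 = mulPoly s.1 f.1 + mulPoly t.1 f.1
    simp)
  zero_smul f := Subtype.ext (by
    change mulPoly (0 : MvPolynomial (Fin n) ℂ) f.1 = 0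
    simp)

/-- The module action is pointwise multiplication. -/
theorem smul_summand_apply {p : n.Partition}
    (s : MvPolynomial.symmetricSubalgebra (Fin n) ℂ) (f : summand lam p) (z : Polydisc n) :
    ((s • f : summand lam p) : Space n lam) z =
      MvPolynomial.eval z.1 (s : MvPolynomial (Fin n) ℂ) * (f : Space n lam) z :=
  mulPoly_apply _ _ z

/-- Unitary equivalence of Hilbert modules over a ring `R`: there is a unitary operator that
intertwines the actions of `R`. -/
def UnitarilyEquivalent (R M N : Type*) [Semiring R]
    [NormedAddCommGroup M] [InnerProductSpace ℂ M] [Module R M]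
    [NormedAddCommGroup N] [InnerProductSpace ℂ N] [Module R N] : Prop :=
  ∃ U : M ≃ₗᵢ[ℂ] N, ∀ (r : R) (f : M), U (r • f) = r • U f

/-- The partition `(3)` of `3`. -/
def part3 : Nat.Partition 3 := ⟨{3}, by decide, by decide⟩

/-- The partition `(2, 1)` of `3`. -/
def part21 : Nat.Partition 3 := ⟨{2, 1}, by decide, by decide⟩

/-- The partition `(1, 1, 1)` of `3`. -/
def part111 : Nat.Partition 3 := ⟨{1, 1, 1}, by decide, by decide⟩

end Bergman

end

noncomputable section

namespace Bergman

/-! ### Feature maps -/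

/-! Two different obstructions separate the summands.

Against $(2,1)$ the obstruction is rank. The summand of a linear character $\varepsilon$ consists of
the $f$ with $f\circ\sigma^{-1}=\varepsilon(\sigma)f$. If $d$ is a polynomial of this type and $U$
is a bounded module map, then for every polynomial $r$ of this type $d^2\cdot r=(rd)\cdot d$ with
$d^2$ and $rd$ symmetric, so $d^2\,Ur=rd\,Ud$. By density of the polynomials, $d\,Uf=f\,Ud$ off the
zeros of $d$ (`apply_eq_of_intertwining`). Hence the values of $Uf$ at two points of one orbit lie
on a line independent of $f$, while the $(2,1)$ summand attains two independent pairs of values. So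
$U$ is not even surjective (`not_equiv_part21`).

Between trivial and sign both modules have rank one, and the metric decides. Let $\Delta$ be the
antisymmetrization of $z^{(2,1,0)}$. Since $(2,1,0)$ is minimal among exponents with distinct
entries, $\Delta$ is a joint eigenvector of the adjoints of the multiplications, with eigenvalue
given by evaluation at $0$ (`IsAlt.inner_mulPoly`). A unitary module map carries it to such an
eigenvector in the symmetric summand, which must be a constant, as $1$ is the kernel function at
$0$. Now multiply by $e_1=z_1+z_2+z_3$: the ratio $\|e_1 g\|^2/\|g\|^2$ is $3/\lambda$ for a nonzero
constant $g$ and $3/(\lambda+2)$ for $\Delta$ (`not_equiv_part3_part111`).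

The analytic input is that monomials span densely and are orthogonal with $\|z^a\|^{-2}$ the kernel
coefficient (`dense_span_mon`, `inner_mon_of_ne`, `inner_mon_self`). The algebraic input is the
character table, extracted from the Young symmetrizers (`trace_span_singleton`, `chi_eq`); it also
gives the orthogonal decomposition. -/

theorem inner_kerFun_one {X H : Type*} [NormedAddCommGroup H] [InnerProductSpace ℂ H]
    [CompleteSpace H] [RKHS ℂ H X ℂ] (x : X) (f : H) :
    inner ℂ (RKHS.kerFun H x 1) f = f x := by
  rw [RKHS.kerFun_inner]
  simp

theorem ext_kerFun {X H F : Type*} [NormedAddCommGroup H] [InnerProductSpace ℂ H]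
    [CompleteSpace H] [RKHS ℂ H X ℂ] [NormedAddCommGroup F] [NormedSpace ℂ F]
    {S T : H →L[ℂ] F} (h : ∀ x, S (RKHS.kerFun H x 1) = T (RKHS.kerFun H x 1)) : S = T := by
  refine ContinuousLinearMap.ext_on (s := {RKHS.kerFun H x v | (x : X) (v : ℂ)}) ?_ ?_
  · have h := RKHS.kerFun_dense (𝕜 := ℂ) H
    rw [dense_iff_closure_eq, ← Submodule.topologicalClosure_coe, h]
    rfl
  · rintro _ ⟨x, v, rfl⟩
    have h1 : RKHS.kerFun H x v = v • RKHS.kerFun H x 1 := by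
      rw [← map_smul]
      simp
    rw [h1, map_smul, map_smul, h]

/-- Sending each kernel function to its feature vector preserves inner products, hence extends from
the dense span to an isometry. The reproducing property then identifies its adjoint as
$e\mapsto\langle\varphi(\cdot),e\rangle$. -/
theorem exists_feature_isometry {X H E : Type*} [NormedAddCommGroup H] [InnerProductSpace ℂ H]
    [CompleteSpace H] [RKHS ℂ H X ℂ] [NormedAddCommGroup E] [InnerProductSpace ℂ E]
    [CompleteSpace E] (φ : X → E)
    (hφ : ∀ x y, inner ℂ (φ x) (φ y) = RKHS.kernel H x y 1) :
    ∃ V : H →L[ℂ] E, (∀ x, V (RKHS.kerFun H x 1) = φ x) ∧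
      (∀ e x, (ContinuousLinearMap.adjoint V e) x = inner ℂ (φ x) e) ∧
      ∀ f, ContinuousLinearMap.adjoint V (V f) = f := by
  classical
  let L : (X →₀ ℂ) →ₗ[ℂ] H := Finsupp.linearCombination ℂ fun x => RKHS.kerFun H x 1
  let L' : (X →₀ ℂ) →ₗ[ℂ] E := Finsupp.linearCombination ℂ φ
  have hdense : DenseRange L := by
    have h := RKHS.kerFun_dense (𝕜 := ℂ) H
    have h' : Submodule.span ℂ {RKHS.kerFun H x v | (x : X) (v : ℂ)} ≤ LinearMap.range L := by
      rw [Submodule.span_le]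
      rintro _ ⟨x, v, rfl⟩
      refine ⟨Finsupp.single x v, ?_⟩
      simp only [L, Finsupp.linearCombination_single]
      rw [← map_smul]
      simp
    have h3 : (LinearMap.range L).topologicalClosure = ⊤ :=
      top_le_iff.1 (h ▸ Submodule.topologicalClosure_mono h')
    intro f
    have : f ∈ (LinearMap.range L).topologicalClosure := h3 ▸ Submodule.mem_top
    rw [← SetLike.mem_coe, Submodule.topologicalClosure_coe] at this
    simpa only [LinearMap.coe_range] using this
  have hinner : ∀ a, inner ℂ (L' a) (L' a) = inner ℂ (L a) (L a) := fun a => by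
    simp only [L, L', Finsupp.linearCombination_apply, Finsupp.sum, sum_inner, inner_sum,
      inner_smul_left, inner_smul_right, hφ, inner_kerFun_one, RKHS.kerFun_apply]
  have hbound : ∀ a, ‖L' a‖ ≤ 1 * ‖L a‖ := fun a => by
    rw [one_mul, @norm_eq_sqrt_re_inner ℂ, @norm_eq_sqrt_re_inner ℂ, hinner]
  let V : H →L[ℂ] E := L'.extendOfNorm L
  have hV : ∀ x, V (RKHS.kerFun H x 1) = φ x := by
    intro x
    have h := LinearMap.extendOfNorm_eq hdense ⟨_, hbound⟩ (Finsupp.single x 1)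
    simpa [L, L', V] using h
  have hadj : ∀ e x, (ContinuousLinearMap.adjoint V e) x = inner ℂ (φ x) e := fun e x => by
    rw [← inner_kerFun_one, ContinuousLinearMap.adjoint_inner_right, hV]
  refine ⟨V, hV, hadj, fun f => ?_⟩
  have h : ContinuousLinearMap.adjoint V ∘L V = ContinuousLinearMap.id ℂ H :=
    ext_kerFun fun y => RKHS.ext fun x => by
      rw [ContinuousLinearMap.comp_apply, hV, hadj, hφ, ContinuousLinearMap.id_apply,
        RKHS.kerFun_apply]
  exact congrArg (fun T : H →L[ℂ] H => T f) h

/-! ### Expansion of the kernel into monomials -/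

/-- Absolute summability is carried along because the induction step multiplies two series. -/
theorem hasSum_prod_pi {n : ℕ} (f : Fin n → ℕ → ℂ) (s : Fin n → ℂ)
    (hs : ∀ i, HasSum (f i) (s i)) :
    HasSum (fun a : Fin n → ℕ => ∏ i, f i (a i)) (∏ i, s i) ∧
      Summable fun a : Fin n → ℕ => ‖∏ i, f i (a i)‖ := by
  induction n with
  | zero =>
    simp only [Finset.univ_eq_empty, Finset.prod_empty]
    exact ⟨by simp, (hasSum_unique _).summable⟩
  | succ n ih =>
    obtain ⟨h1, h2⟩ := ih (fun i => f i.succ) (fun i => s i.succ) fun i => hs i.succ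
    have h0 : Summable fun j => ‖f 0 j‖ := summable_norm_iff.2 (hs 0).summable
    have hm' := h0.mul_norm h2
    have hm := (hs 0).mul h1 hm'.of_norm
    rw [Fin.prod_univ_succ]
    constructor
    · refine (Equiv.hasSum_iff (Fin.consEquiv fun _ : Fin (n + 1) => ℕ)).1
        (hm.congr_fun fun p => ?_)
      simp [Fin.prod_univ_succ]
    · refine (Equiv.summable_iff (Fin.consEquiv fun _ : Fin (n + 1) => ℕ)).1
        (hm'.congr fun p => ?_)
      simp [Fin.prod_univ_succ]

/-- The coefficient of the monomial with exponent `a` in the expansion of the kernel. -/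
def kerCoeff (lam : ℝ) {n : ℕ} (a : Fin n → ℕ) : ℝ := ∏ i, binomCoeff lam (a i)

theorem binomCoeff_pos {r : ℝ} (hr : 0 < r) : ∀ j, 0 < binomCoeff r j
  | 0 => zero_lt_one
  | j + 1 => by
    have := binomCoeff_pos hr j
    rw [binomCoeff]
    positivity

variable {n : ℕ} {lam : ℝ}

theorem kerCoeff_pos (h : 0 < lam) (a : Fin n → ℕ) : 0 < kerCoeff lam a :=
  Finset.prod_pos fun i _ => binomCoeff_pos h (a i)

theorem hasSum_kernelFun (z w : Polydisc n) :
    HasSum (fun a : Fin n → ℕ => (kerCoeff lam a : ℂ) * ((∏ i, z.1 i ^ a i) *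
      conj (∏ i, w.1 i ^ a i))) (kernelFun n lam z w) := by
  refine ((hasSum_prod_pi (fun i j => (binomCoeff lam j : ℂ) * (z.1 i * conj (w.1 i)) ^ j) _
    fun i => hasSum_one_sub_cpow lam ?_).1).congr_fun fun a => ?_
  · rw [norm_mul, RCLike.norm_conj]
    exact mul_lt_one_of_nonneg_of_lt_one_left (norm_nonneg _) (z.2 i) (w.2 i).le
  · rw [kerCoeff, Complex.ofReal_prod, map_prod, ← Finset.prod_mul_distrib,
      ← Finset.prod_mul_distrib]
    exact Finset.prod_congr rfl fun i _ => by rw [mul_pow, map_pow]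

theorem kernelFun_zero_right (z : Polydisc n) : kernelFun n lam z ⟨0, by simp⟩ = 1 := by
  simp [kernelFun]

/-- The rotation of the coordinate `i` of a point of the polydisc by `u`. -/
def rotPoint (i : Fin n) (u : ℂ) (hu : ‖u‖ = 1) (z : Polydisc n) : Polydisc n :=
  ⟨fun j => if j = i then u * z.1 j else z.1 j, fun j => by
    have := z.2 j
    beta_reduce
    split_ifs <;> simpa [hu]⟩

theorem kernelFun_rotPoint (i : Fin n) (u : ℂ) (hu : ‖u‖ = 1) (hu' : ‖conj u‖ = 1)
    (z w : Polydisc n) :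
    kernelFun n lam (rotPoint i u hu z) w = kernelFun n lam z (rotPoint i (conj u) hu' w) := by
  refine Finset.prod_congr rfl fun j _ => ?_
  simp only [rotPoint]
  split_ifs with h
  · simp only [map_mul, Complex.conj_conj]
    ring_nf
  · rfl

/-! ### Polynomials in the Bergman space and density of the monomials -/

variable [Fact (0 < lam)]

/-- The kernel function at the origin is the constant $1$; applying multiplication operators to it
puts every polynomial in the space. -/
instance : One (Space n lam) := ⟨RKHS.kerFun (Space n lam) ⟨0, by simp⟩ 1⟩

theorem one_apply (z : Polydisc n) : (1 : Space n lam) z = 1 := by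
  change RKHS.kerFun (Space n lam) ⟨0, by simp⟩ 1 z = 1
  rw [RKHS.kerFun_apply, kernel_space, kernelFun_zero_right, mul_one]

/-- A polynomial as an element of the weighted Bergman space. -/
def ofPoly : MvPolynomial (Fin n) ℂ →ₗ[ℂ] Space n lam where
  toFun p := mulPoly p 1
  map_add' p q := by simp
  map_smul' c p := by simp

theorem ofPoly_apply (p : MvPolynomial (Fin n) ℂ) (z : Polydisc n) :
    (ofPoly p : Space n lam) z = MvPolynomial.eval z.1 p := by
  change mulPoly p (1 : Space n lam) z = _
  rw [mulPoly_apply, one_apply, mul_one]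

theorem mulPoly_ofPoly (p q : MvPolynomial (Fin n) ℂ) :
    mulPoly p (ofPoly q : Space n lam) = ofPoly (p * q) :=
  RKHS.ext fun z => by rw [mulPoly_apply, ofPoly_apply, ofPoly_apply, map_mul]

theorem ofPoly_one : (ofPoly 1 : Space n lam) = 1 :=
  RKHS.ext fun z => by rw [ofPoly_apply, map_one, one_apply]

/-- The monomial with exponent `a` as a polynomial. -/
def mon (a : Fin n → ℕ) : MvPolynomial (Fin n) ℂ := ∏ i, MvPolynomial.X i ^ a i

theorem eval_mon (a : Fin n → ℕ) (z : Fin n → ℂ) :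
    MvPolynomial.eval z (mon a) = ∏ i, z i ^ a i := by
  simp [mon]

theorem mon_add (a b : Fin n → ℕ) : mon (a + b) = mon a * mon b := by
  simp [mon, pow_add, Finset.prod_mul_distrib]

theorem mon_zero : mon (0 : Fin n → ℕ) = 1 := by simp [mon]

theorem span_range_mon : Submodule.span ℂ (Set.range (mon (n := n))) = ⊤ := by
  refine eq_top_iff.2 fun p _ => ?_
  rw [p.as_sum]
  refine Submodule.sum_mem _ fun a _ => ?_
  have h : MvPolynomial.monomial a (p.coeff a) = p.coeff a • mon a := by
    rw [MvPolynomial.monomial_eq, MvPolynomial.smul_eq_C_mul, mon,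
      Finsupp.prod_fintype _ _ (by simp)]
  rw [h]
  exact Submodule.smul_mem _ _ (Submodule.subset_span ⟨_, rfl⟩)

/-- The monomial expansion of the kernel says that $w\mapsto(\sqrt{c_a}\,\overline{w^a})_a$ is a
feature map into $\ell^2$. The identity $V^*V=1$ yields both the density of monomials and the
expansion of kernel functions. -/
theorem exists_coeff_isometry : ∃ V : Space n lam →L[ℂ] lp (fun _ : Fin n → ℕ => ℂ) 2,
    (∀ w a, V (RKHS.kerFun (Space n lam) w 1) a =
      (√(kerCoeff lam a) : ℂ) * conj (∏ i, w.1 i ^ a i)) ∧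
    (∀ a, ContinuousLinearMap.adjoint V (lp.single 2 a 1) = (√(kerCoeff lam a) : ℂ) •
      ofPoly (mon a)) ∧
    ∀ f, ContinuousLinearMap.adjoint V (V f) = f := by
  have hl : 0 < lam := Fact.out
  have hsq : ∀ a : Fin n → ℕ, (√(kerCoeff lam a) : ℂ) * √(kerCoeff lam a) = kerCoeff lam a :=
    fun a => by
      rw [← Complex.ofReal_mul, Real.mul_self_sqrt (kerCoeff_pos hl a).le]
  have hmem : ∀ w : Polydisc n, Memℓp (fun a : Fin n → ℕ =>
      (√(kerCoeff lam a) : ℂ) * conj (∏ i, w.1 i ^ a i)) 2 := fun w => by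
    refine memℓp_gen ?_
    have h := (hasSum_kernelFun (lam := lam) w w).summable.norm
    refine h.congr fun a => ?_
    rw [ENNReal.toReal_ofNat, Real.rpow_ofNat, sq, ← norm_mul, mul_mul_mul_comm, hsq, norm_mul,
      norm_mul, norm_mul, norm_mul, RCLike.norm_conj]
  obtain ⟨V, h1, h2, h3⟩ := exists_feature_isometry (H := Space n lam)
    (E := lp (fun _ : Fin n → ℕ => ℂ) 2) (fun w => ⟨_, hmem w⟩) fun z w => by
      rw [kernel_space, mul_one]
      refine (lp.hasSum_inner _ _).unique ((hasSum_kernelFun z w).congr_fun fun a => ?_)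
      simp only [RCLike.inner_apply, map_mul, Complex.conj_conj, Complex.conj_ofReal]
      rw [← hsq]
      ring
  refine ⟨V, fun w a => by rw [h1], fun a => RKHS.ext fun z => ?_, h3⟩
  classical
  rw [h2, lp.inner_single_right, RKHS.coe_smul, Pi.smul_apply, ofPoly_apply, eval_mon]
  simp [RCLike.inner_apply]

theorem dense_span_mon : Dense (Submodule.span ℂ
    (Set.range fun a : Fin n → ℕ => (ofPoly (mon a) : Space n lam)) : Set (Space n lam)) := by
  classical
  have hl : 0 < lam := Fact.out
  obtain ⟨V, -, h2, h3⟩ := exists_coeff_isometry (n := n) (lam := lam)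
  rw [Submodule.dense_iff_topologicalClosure_eq_top, Submodule.topologicalClosure_eq_top_iff,
    Submodule.eq_bot_iff]
  intro f hf
  rw [Submodule.mem_orthogonal] at hf
  rw [← h3 f]
  suffices V f = 0 by rw [this, map_zero]
  ext a
  have h := hf _ (Submodule.subset_span ⟨a, rfl⟩)
  have h' : inner ℂ (ContinuousLinearMap.adjoint V (lp.single 2 a 1)) f = 0 := by
    rw [h2, inner_smul_left, h, mul_zero]
  rw [ContinuousLinearMap.adjoint_inner_left, lp.inner_single_left] at h'
  simpa [RCLike.inner_apply] using h'

theorem ext_mon {F : Type*} [NormedAddCommGroup F] [NormedSpace ℂ F] {S T : Space n lam →L[ℂ] F}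
    (h : ∀ a, S (ofPoly (mon a)) = T (ofPoly (mon a))) : S = T :=
  ContinuousLinearMap.ext_on dense_span_mon (by rintro _ ⟨a, rfl⟩; exact h a)

theorem hasSum_kerFun (w : Polydisc n) : HasSum (fun a : Fin n → ℕ =>
    ((kerCoeff lam a : ℂ) * conj (∏ i, w.1 i ^ a i)) • (ofPoly (mon a) : Space n lam))
    (RKHS.kerFun (Space n lam) w 1) := by
  classical
  have hl : 0 < lam := Fact.out
  obtain ⟨V, h1, h2, h3⟩ := exists_coeff_isometry (n := n) (lam := lam)
  have h := (lp.hasSum_single (by simp) (V (RKHS.kerFun (Space n lam) w 1))).mapL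
    (ContinuousLinearMap.adjoint V)
  rw [h3] at h
  refine h.congr_fun fun a => ?_
  have h4 : (lp.single 2 a (V (RKHS.kerFun (Space n lam) w 1) a) :
      lp (fun _ : Fin n → ℕ => ℂ) 2) =
      V (RKHS.kerFun (Space n lam) w 1) a • lp.single 2 a 1 := by
    rw [← lp.single_smul, smul_eq_mul, mul_one]
  rw [h4, map_smul, h2, h1, smul_smul]
  congr 1
  rw [mul_right_comm, ← Complex.ofReal_mul, Real.mul_self_sqrt (kerCoeff_pos hl a).le]

/-! ### Adjoints of composition operators and the inner products of monomials -/

/-- The kernel identity gives $Tk_z=k_{\tau' z}$, so $T^*$ is composition with $\tau'$. -/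
theorem inner_comp_eq (τ τ' : Polydisc n → Polydisc n) (S T : Space n lam →L[ℂ] Space n lam)
    (hT : ∀ f z, T f z = f (τ z)) (hS : ∀ f z, S f z = f (τ' z))
    (hk : ∀ z w, kernelFun n lam (τ z) w = kernelFun n lam z (τ' w)) (f g : Space n lam) :
    inner ℂ (T f) g = inner ℂ f (S g) := by
  rw [← ContinuousLinearMap.adjoint_inner_right]
  congr 1
  refine RKHS.ext fun z => ?_
  have h : T (RKHS.kerFun (Space n lam) z 1) = RKHS.kerFun (Space n lam) (τ' z) 1 :=
    RKHS.ext fun x => by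
      rw [hT, RKHS.kerFun_apply, RKHS.kerFun_apply, kernel_space, kernel_space, hk]
  rw [← inner_kerFun_one, ContinuousLinearMap.adjoint_inner_right, h, inner_kerFun_one, hS]

theorem inner_permOp (σ : Equiv.Perm (Fin n)) (f g : Space n lam) :
    inner ℂ (permOp σ f) g = inner ℂ f (permOp σ⁻¹ g) := by
  refine inner_comp_eq _ _ _ _ (permOp_apply σ) (permOp_apply σ⁻¹) (fun z w => ?_) f g
  refine Eq.trans ?_ (Equiv.prod_comp σ _)
  simp [permPoint, kernelFun]

theorem rotPoint_conj (i : Fin n) (u : ℂ) (hu : ‖u‖ = 1) (hu' : ‖conj u‖ = 1) (z : Polydisc n) :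
    rotPoint i (conj u) hu' (rotPoint i u hu z) = z := by
  refine Subtype.ext (funext fun j => ?_)
  simp only [rotPoint]
  split_ifs
  · rw [← mul_assoc, Complex.conj_mul', hu]
    simp
  · rfl

theorem exists_rotOp (i : Fin n) (u : ℂ) (hu : ‖u‖ = 1) :
    ∃ T : Space n lam →L[ℂ] Space n lam, ∀ f z, T f z = f (rotPoint i u hu z) := by
  have hu' : ‖conj u‖ = 1 := by rwa [RCLike.norm_conj]
  obtain ⟨T, hT⟩ := exists_weightedComp (H := Space n lam) (fun _ => 1) (rotPoint i u hu) 1 (by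
    have h0 : ∀ z w : Polydisc n,
        kernelFun n lam (rotPoint i u hu z) (rotPoint i u hu w) = kernelFun n lam z w :=
      fun z w => by rw [kernelFun_rotPoint i u hu hu', rotPoint_conj]
    simp only [kernel_space, h0]
    exact ⟨by simp, by simp⟩)
  exact ⟨T, fun f z => by rw [hT, one_mul]⟩

theorem inner_mon_of_lt {a b : Fin n → ℕ} {i : Fin n} (h : a i < b i) :
    inner ℂ (ofPoly (mon a) : Space n lam) (ofPoly (mon b)) = 0 := by
  let k : ℕ := b i - a i
  have hk : (k : ℂ) ≠ 0 := Nat.cast_ne_zero.2 (Nat.sub_pos_of_lt h).ne'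
  -- With $u^k=-1$, rotating coordinate $i$ by $u$ scales the two monomials by opposite factors, so
  -- their inner product equals its own negative.
  let u : ℂ := Complex.exp ((Real.pi / k : ℝ) * Complex.I)
  have hu : ‖u‖ = 1 := Complex.norm_exp_ofReal_mul_I _
  have hu' : ‖conj u‖ = 1 := by rwa [RCLike.norm_conj]
  have huk : u ^ k = -1 := by
    rw [← Complex.exp_pi_mul_I, ← Complex.exp_nat_mul]
    congr 1
    push_cast
    field_simp
  obtain ⟨S, hS⟩ := exists_rotOp (n := n) (lam := lam) i u hu
  obtain ⟨T, hT⟩ := exists_rotOp (n := n) (lam := lam) i (conj u) hu'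
  have key : ∀ (v : ℂ) (hv : ‖v‖ = 1) (R : Space n lam →L[ℂ] Space n lam),
      (∀ f z, R f z = f (rotPoint i v hv z)) → ∀ c : Fin n → ℕ,
      R (ofPoly (mon c)) = v ^ c i • ofPoly (mon c) := fun v hv R hR c => by
    refine RKHS.ext fun z => ?_
    rw [hR, RKHS.coe_smul, Pi.smul_apply, ofPoly_apply, ofPoly_apply, eval_mon, eval_mon,
      smul_eq_mul, ← Finset.mul_prod_erase _ _ (Finset.mem_univ i),
      ← Finset.mul_prod_erase _ (fun j => z.1 j ^ c j) (Finset.mem_univ i), ← mul_assoc]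
    congr 1
    · simp [rotPoint, mul_pow]
    · refine Finset.prod_congr rfl fun j hj => ?_
      simp [rotPoint, Finset.ne_of_mem_erase hj]
  have h1 := inner_comp_eq (rotPoint i (conj u) hu') (rotPoint i u hu) S T hT hS
    (fun z w => by
      rw [kernelFun_rotPoint i (conj u) hu' (by simpa using hu)]
      simp) (ofPoly (mon a)) (ofPoly (mon b))
  rw [key _ _ T hT, key _ _ S hS, inner_smul_left, inner_smul_right, map_pow,
    Complex.conj_conj] at h1
  have hb : u ^ b i = - u ^ a i := by
    rw [show b i = a i + k by omega, pow_add, huk]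
    ring
  rw [hb] at h1
  have h0 : u ^ a i ≠ 0 := pow_ne_zero _ (Complex.exp_ne_zero _)
  have h2 : (2 * u ^ a i) * inner ℂ (ofPoly (mon a) : Space n lam) (ofPoly (mon b)) = 0 := by
    linear_combination h1
  exact (mul_eq_zero.1 h2).resolve_left (mul_ne_zero two_ne_zero h0)

theorem inner_mon_of_ne {a b : Fin n → ℕ} (h : a ≠ b) :
    inner ℂ (ofPoly (mon a) : Space n lam) (ofPoly (mon b)) = 0 := by
  obtain ⟨i, hi⟩ := Function.ne_iff.1 h
  rcases lt_or_gt_of_ne hi with hi | hi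
  · exact inner_mon_of_lt hi
  · rw [← inner_conj_symm, inner_mon_of_lt hi, map_zero]

theorem inner_mon_self (a : Fin n → ℕ) :
    inner ℂ (ofPoly (mon a) : Space n lam) (ofPoly (mon a)) = (kerCoeff lam a : ℂ)⁻¹ := by
  have hl : 0 < lam := Fact.out
  let w : Polydisc n := ⟨fun _ => 1 / 2, fun _ => by norm_num⟩
  -- Pairing $z^a$ with the expansion of $k_w$ leaves one term, while the reproducing property gives
  -- $\overline{w^a}$; the point $w$ has no zero coordinate, so this can be cancelled.
  have h := (hasSum_kerFun (lam := lam) w).mapL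
    (innerSL ℂ (ofPoly (mon a) : Space n lam))
  have h1 := h.unique (hasSum_single a fun b hb => by
    rw [map_smul, innerSL_apply_apply, inner_mon_of_ne hb.symm, smul_zero])
  rw [map_smul, innerSL_apply_apply, ← inner_conj_symm, inner_kerFun_one, ofPoly_apply,
    eval_mon, smul_eq_mul, mul_right_comm] at h1
  have hw : conj (∏ i, w.1 i ^ a i) ≠ 0 := by
    rw [Ne, map_eq_zero]
    exact Finset.prod_ne_zero_iff.2 fun i _ => pow_ne_zero _ (by norm_num [w])
  have h2 := mul_right_cancel₀ hw ((one_mul _).trans h1)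
  exact eq_inv_of_mul_eq_one_right h2.symm

/-! ### Characters from quasi-idempotents of a group algebra -/

section GroupAlgebra

variable {G : Type*} [Group G] [Fintype G]

/-- The element of the complex group algebra with the integral coefficients `f`. -/
def intElem (f : G → ℤ) : MonoidAlgebra ℂ G := ∑ a, (f a : ℂ) • MonoidAlgebra.of ℂ G a

/-- The convolution of two integer-valued functions on a finite group. -/
def convInt (f g : G → ℤ) (x : G) : ℤ := ∑ a, f a * g (a⁻¹ * x)

/-- Integer coefficients make identities in the group algebra of a concrete finite group decidable
by evaluation. -/
theorem intElem_mul (f g : G → ℤ) : intElem f * intElem g = intElem (convInt f g) := by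
  simp only [intElem, convInt, Finset.sum_mul_sum, Int.cast_sum, Finset.sum_smul]
  rw [Finset.sum_comm (f := fun x a => ((f a * g (a⁻¹ * x) : ℤ) : ℂ) • MonoidAlgebra.of ℂ G x)]
  refine Finset.sum_congr rfl fun a _ => ?_
  refine Eq.trans ?_ (Equiv.sum_comp (Equiv.mulLeft a) _)
  refine Finset.sum_congr rfl fun b _ => ?_
  rw [smul_mul_smul_comm, ← map_mul]
  simp

theorem coeff_intElem (f : G → ℤ) (x : G) : (intElem f).coeff x = f x := by
  classical
  simp [intElem, MonoidAlgebra.of_apply, Finsupp.single_apply]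

/-- The map $x\mapsto\kappa^{-1}xc$ projects the group algebra onto the left ideal. By cyclicity,
the trace of $\sigma$ on the ideal is that of $x\mapsto\kappa^{-1}\sigma xc$ on the whole algebra,
read off in the basis of group elements. -/
theorem trace_span_singleton (c : MonoidAlgebra ℂ G) (κ : ℂ) (hκ : κ ≠ 0) (hc : c * c = κ • c)
    (σ : G) :
    LinearMap.trace ℂ (Submodule.span (MonoidAlgebra ℂ G) {c})
      (Algebra.lsmul ℂ ℂ (Submodule.span (MonoidAlgebra ℂ G) {c}) (MonoidAlgebra.of ℂ G σ)) =
    κ⁻¹ * ∑ g, c.coeff (g⁻¹ * σ⁻¹ * g) := by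
  classical
  let W := Submodule.span (MonoidAlgebra ℂ G) {c}
  let ι : W →ₗ[ℂ] MonoidAlgebra ℂ G := (W.restrictScalars ℂ).subtype
  let P : MonoidAlgebra ℂ G →ₗ[ℂ] W :=
    { toFun := fun x => ⟨κ⁻¹ • (x * c), Submodule.smul_of_tower_mem _ _
        (Submodule.mem_span_singleton.2 ⟨x, rfl⟩)⟩
      map_add' := fun x y => Subtype.ext (by simp [add_mul])
      map_smul' := fun a x => Subtype.ext (by simp [smul_comm κ⁻¹ a]) }
  have hP : ∀ w : W, P (ι w) = w := by
    rintro ⟨w, hw⟩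
    obtain ⟨x, rfl⟩ := Submodule.mem_span_singleton.1 hw
    refine Subtype.ext ?_
    change κ⁻¹ • ((x * c) * c) = x * c
    rw [mul_assoc, hc, mul_smul_comm, smul_smul, inv_mul_cancel₀ hκ, one_smul]
  have hfac : Algebra.lsmul ℂ ℂ W (MonoidAlgebra.of ℂ G σ) =
      P ∘ₗ (LinearMap.mulLeft ℂ (MonoidAlgebra.of ℂ G σ) ∘ₗ ι) := by
    refine LinearMap.ext fun w => ?_
    obtain ⟨w, hw⟩ := w
    obtain ⟨x, rfl⟩ := Submodule.mem_span_singleton.1 hw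
    refine Subtype.ext ?_
    change MonoidAlgebra.of ℂ G σ * (x * c) = κ⁻¹ • ((MonoidAlgebra.of ℂ G σ * (x * c)) * c)
    rw [mul_assoc, mul_assoc x, hc, mul_smul_comm, mul_smul_comm, smul_smul,
      inv_mul_cancel₀ hκ, one_smul]
  let b : Module.Basis G ℂ (MonoidAlgebra ℂ G) :=
    Module.Basis.ofRepr (MonoidAlgebra.coeffLinearEquiv ℂ)
  change LinearMap.trace ℂ W (Algebra.lsmul ℂ ℂ W (MonoidAlgebra.of ℂ G σ)) = _
  rw [hfac, LinearMap.trace_comp_comm', LinearMap.trace_eq_matrix_trace ℂ b, Matrix.trace,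
    Finset.mul_sum]
  refine Finset.sum_congr rfl fun g _ => ?_
  rw [Matrix.diag_apply, LinearMap.toMatrix_apply]
  have hb : b g = MonoidAlgebra.of ℂ G g := rfl
  have hr : ∀ x, b.repr x g = x.coeff g := fun x => rfl
  rw [hb, hr]
  change (MonoidAlgebra.of ℂ G σ * (κ⁻¹ • (MonoidAlgebra.of ℂ G g * c))).coeff g = _
  rw [mul_smul_comm, ← mul_assoc, ← map_mul]
  simp [MonoidAlgebra.of_apply, MonoidAlgebra.coeff_single_mul_apply]

end GroupAlgebra

/-! ### The characters of the symmetric group on three letters -/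

/-- The coefficients of the Young symmetrizer of a filling whose boxes are `bx`. -/
def youngCoeff {n : ℕ} (bx : Fin n → ℕ × ℕ) : Equiv.Perm (Fin n) → ℤ :=
  convInt (fun σ => if ∀ k, (bx (σ k)).1 = (bx k).1 then 1 else 0)
    (fun σ => if ∀ k, (bx (σ k)).2 = (bx k).2 then Equiv.Perm.sign σ else 0)

theorem youngSymmetrizer_eq {n : ℕ} (p : n.Partition) :
    youngSymmetrizer p = intElem (youngCoeff (box p)) := by
  classical
  rw [youngCoeff, ← intElem_mul, youngSymmetrizer, intElem, intElem, Finset.sum_filter,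
    Finset.sum_filter]
  congr 1
  · refine Finset.sum_congr rfl fun σ _ => ?_
    by_cases h : ∀ k, (box p (σ k)).1 = (box p k).1 <;> simp [h]
  · refine Finset.sum_congr rfl fun σ _ => ?_
    by_cases h : ∀ k, (box p (σ k)).2 = (box p k).2 <;> simp [h]

theorem chi_eq {n : ℕ} (p : n.Partition) (bx : Fin n → ℕ × ℕ) (hb : box p = bx) (κ : ℤ)
    (hκ : κ ≠ 0) (hc : ∀ σ, convInt (youngCoeff bx) (youngCoeff bx) σ = κ * youngCoeff bx σ)
    (X : Equiv.Perm (Fin n) → ℤ)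
    (hX : ∀ σ, ∑ g, youngCoeff bx (g⁻¹ * σ⁻¹ * g) = κ * X σ) (σ : Equiv.Perm (Fin n)) :
    chi p σ = X σ := by
  have hy := youngSymmetrizer_eq p
  rw [hb] at hy
  have hκ' : (κ : ℂ) ≠ 0 := Int.cast_ne_zero.2 hκ
  have h := trace_span_singleton (youngSymmetrizer p) κ hκ' (by
    rw [hy, intElem_mul, funext hc]
    simp only [intElem, Finset.smul_sum, smul_smul, Int.cast_mul]) σ
  rw [hy] at h
  simp only [coeff_intElem, ← Int.cast_sum, hX] at h
  rw [Int.cast_mul, inv_mul_cancel_left₀ hκ', ← hy] at h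
  exact h

theorem box_part3 : box part3 = ![(0, 0), (0, 1), (0, 2)] := by
  have h : boxes part3 = [(0, 0), (0, 1), (0, 2)] := by
    simp [boxes, part3, List.range_succ]
  funext k
  rw [box, h]
  fin_cases k <;> rfl

theorem box_part21 : box part21 = ![(0, 0), (0, 1), (1, 0)] := by
  have h : boxes part21 = [(0, 0), (0, 1), (1, 0)] := by
    simp only [boxes, part21]
    rw [Multiset.insert_eq_cons, Multiset.sort_cons _ _ _ (by simp), Multiset.sort_singleton]
    simp [List.range_succ]
  funext k
  rw [box, h]
  fin_cases k <;> rfl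

theorem box_part111 : box part111 = ![(0, 0), (1, 0), (2, 0)] := by
  have h : boxes part111 = [(0, 0), (1, 0), (2, 0)] := by
    simp only [boxes, part111]
    rw [Multiset.insert_eq_cons, Multiset.insert_eq_cons, Multiset.sort_cons _ _ _ (by simp),
      Multiset.sort_cons _ _ _ (by simp), Multiset.sort_singleton]
    simp [List.range_succ]
  funext k
  rw [box, h]
  fin_cases k <;> rfl

/-- Here and for the other two partitions the scalar of the quasi-idempotent is $3!/\chi(1)$, that
is $6$, $3$ and $6$; the rest is a finite check over six permutations. -/
theorem chi_part3 (σ : Equiv.Perm (Fin 3)) : chi part3 σ = (1 : ℤ) :=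
  chi_eq part3 _ box_part3 6 (by decide) (by decide +kernel) (fun _ => 1) (by decide +kernel) σ

theorem chi_part111 (σ : Equiv.Perm (Fin 3)) : chi part111 σ = (Equiv.Perm.sign σ : ℤ) :=
  chi_eq part111 _ box_part111 6 (by decide) (by decide +kernel)
    (fun σ => (Equiv.Perm.sign σ : ℤ)) (by decide +kernel) σ

/-- The character of the two-dimensional irreducible representation of the symmetric group on
three letters: the number of fixed points minus one. -/
def stdChar (σ : Equiv.Perm (Fin 3)) : ℤ := (∑ i, if σ i = i then 1 else 0) - 1

theorem chi_part21 (σ : Equiv.Perm (Fin 3)) : chi part21 σ = stdChar σ :=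
  chi_eq part21 _ box_part21 3 (by decide) (by decide +kernel) stdChar (by decide +kernel) σ

variable {n : ℕ} {lam : ℝ} [Fact (0 < lam)]

/-! ### The action of the group algebra on the weighted Bergman space -/

theorem permOp_mul (σ τ : Equiv.Perm (Fin n)) (f : Space n lam) :
    permOp σ (permOp τ f) = permOp (σ * τ) f :=
  RKHS.ext fun z => by
    rw [permOp_apply, permOp_apply, permOp_apply]
    congr 1

theorem permOp_one (f : Space n lam) : permOp 1 f = f :=
  RKHS.ext fun z => by
    rw [permOp_apply]
    congr 1

theorem permOp_ofPoly (σ : Equiv.Perm (Fin n)) (q : MvPolynomial (Fin n) ℂ) :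
    permOp σ (ofPoly q : Space n lam) = ofPoly (MvPolynomial.rename σ q) :=
  RKHS.ext fun z => by
    rw [permOp_apply, ofPoly_apply, ofPoly_apply, MvPolynomial.eval_rename]
    congr 2

theorem rename_mon (σ : Equiv.Perm (Fin n)) (a : Fin n → ℕ) :
    MvPolynomial.rename σ (mon a) = mon (a ∘ σ.symm) := by
  simp only [mon, map_prod, map_pow, MvPolynomial.rename_X]
  refine Eq.trans ?_ (Equiv.prod_comp σ _)
  simp

/-- The operator `∑ σ, f σ • R_σ`. -/
def intOp (f : Equiv.Perm (Fin n) → ℤ) : Space n lam →L[ℂ] Space n lam :=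
  ∑ σ, (f σ : ℂ) • permOp σ

theorem intOp_apply (f : Equiv.Perm (Fin n) → ℤ) (x : Space n lam) :
    intOp f x = ∑ σ, (f σ : ℂ) • permOp σ x := by
  simp [intOp]

theorem intOp_intOp (f g : Equiv.Perm (Fin n) → ℤ) (x : Space n lam) :
    intOp f (intOp g x) = intOp (convInt f g) x := by
  simp only [intOp_apply, convInt, map_sum, map_smul, permOp_mul, Int.cast_sum, Finset.sum_smul,
    Finset.smul_sum, smul_smul]
  rw [Finset.sum_comm (f := fun σ a => ((f a * g (a⁻¹ * σ) : ℤ) : ℂ) • permOp σ x),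
    Finset.sum_comm]
  refine Finset.sum_congr rfl fun a _ => ?_
  refine Eq.trans ?_ (Equiv.sum_comp (Equiv.mulLeft a) _)
  simp [mul_comm]

theorem inner_intOp (f : Equiv.Perm (Fin n) → ℤ) (x y : Space n lam) :
    inner ℂ (intOp f x) y = inner ℂ x (intOp (fun σ => f σ⁻¹) y) := by
  simp only [intOp_apply, sum_inner, inner_sum, inner_smul_left, inner_smul_right, inner_permOp,
    map_intCast]
  refine Eq.trans ?_ (Equiv.sum_comp (Equiv.inv _) _)
  simp

theorem proj_eq (p : n.Partition) (X : Equiv.Perm (Fin n) → ℤ) (hX : ∀ σ, chi p σ = X σ) :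
    proj lam p = ((X 1 : ℂ) / n.factorial) • intOp X := by
  simp [proj, intOp, hX]

theorem summand_isOrtho {p q : n.Partition} {X Y : Equiv.Perm (Fin n) → ℤ}
    (hX : ∀ σ, chi p σ = X σ) (hY : ∀ σ, chi q σ = Y σ)
    (h : ∀ σ, convInt (fun σ => X σ⁻¹) Y σ = 0) : summand lam p ⟂ summand lam q := by
  rw [Submodule.isOrtho_iff_inner_eq]
  rintro _ ⟨f, rfl⟩ _ ⟨g, rfl⟩
  have h0 : intOp (convInt (fun σ => X σ⁻¹) Y) g = 0 := by
    rw [intOp_apply]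
    simp [h]
  simp only [ContinuousLinearMap.coe_coe]
  rw [proj_eq p X hX, proj_eq q Y hY, smul_apply, smul_apply, inner_smul_left, inner_smul_right,
    inner_intOp, intOp_intOp, h0, inner_zero_right, mul_zero, mul_zero]

theorem summand_sup_eq_top :
    summand lam part3 ⊔ summand lam part21 ⊔ summand lam part111 = ⊤ := by
  refine eq_top_iff.2 fun f _ => ?_
  have hmem : ∀ p : Nat.Partition 3, proj lam p f ∈ summand lam p := fun p => ⟨f, rfl⟩
  have hf : f = proj lam part3 f + proj lam part21 f + proj lam part111 f := by
    -- Decomposition of the regular character: $\sum_\chi\chi(1)\chi$ is $6$ at the identity and $0$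
    -- elsewhere, so the three projections add up to the identity.
    have h : ∀ σ : Equiv.Perm (Fin 3), (1 : ℤ) * 1 + 2 * stdChar σ + 1 * Equiv.Perm.sign σ =
        if σ = 1 then 6 else 0 := by decide +kernel
    have h2 : (stdChar 1 : ℤ) = 2 := by decide +kernel
    rw [proj_eq _ _ chi_part3, proj_eq _ _ chi_part21, proj_eq _ _ chi_part111, h2]
    simp only [smul_apply, intOp_apply, Finset.smul_sum, smul_smul, ← Finset.sum_add_distrib,
      ← add_smul]
    rw [Finset.sum_eq_single 1]
    · have h1 := h 1
      rw [if_pos rfl] at h1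
      have h1' : ((1 : ℤ) * 1 + 2 * stdChar 1 + 1 * (Equiv.Perm.sign (1 : Equiv.Perm (Fin 3)) : ℤ)
        : ℂ) = 6 := by exact_mod_cast h1
      rw [permOp_one]
      have : ∀ c : ℂ, c = 1 → f = c • f := fun c hc => by rw [hc, one_smul]
      apply this
      simp only [Nat.factorial, map_one, Units.val_one] at h1' ⊢
      push_cast at h1' ⊢
      linear_combination h1' / 6
    · intro σ _ hσ
      have h1 := h σ
      rw [if_neg hσ] at h1
      have h1' : ((1 : ℤ) * 1 + 2 * stdChar σ + 1 * (Equiv.Perm.sign σ : ℤ) : ℂ) = 0 := by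
        exact_mod_cast h1
      have : ∀ (c : ℂ) (x : Space 3 lam), c = 0 → c • x = 0 := fun c x hc => by
        rw [hc, zero_smul]
      apply this
      simp only [Nat.factorial, map_one, Units.val_one] at h1' ⊢
      push_cast at h1' ⊢
      linear_combination h1' / 6
    · simp
  rw [hf]
  exact Submodule.add_mem _ (Submodule.mem_sup_left (Submodule.add_mem _
    (Submodule.mem_sup_left (hmem _)) (Submodule.mem_sup_right (hmem _))))
    (Submodule.mem_sup_right (hmem _))

/-! ### Summands of linear characters -/

section LinearCharacter

variable (ε : Equiv.Perm (Fin n) →* ℤˣ)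

theorem permOp_intOp_unit (σ : Equiv.Perm (Fin n)) (x : Space n lam) :
    permOp σ (intOp (fun τ => (ε τ : ℤ)) x) =
      ((ε σ : ℤ) : ℂ) • intOp (fun τ => (ε τ : ℤ)) x := by
  simp only [intOp_apply, map_sum, map_smul, permOp_mul, Finset.smul_sum, smul_smul]
  refine Eq.trans ?_ (Equiv.sum_comp (Equiv.mulLeft σ) _)
  refine Finset.sum_congr rfl fun τ _ => ?_
  congr 1
  rw [Equiv.coe_mulLeft, map_mul, Units.val_mul, Int.cast_mul, ← mul_assoc, ← Int.cast_mul,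
    ← Units.val_mul, Int.units_mul_self]
  simp

theorem intOp_unit_of_permOp {x : Space n lam}
    (hx : ∀ σ, permOp σ x = ((ε σ : ℤ) : ℂ) • x) :
    intOp (fun τ => (ε τ : ℤ)) x = (n.factorial : ℂ) • x := by
  simp only [intOp_apply, hx, smul_smul, ← Int.cast_mul, ← Units.val_mul, Int.units_mul_self]
  simp [Fintype.card_perm, ← Nat.cast_smul_eq_nsmul ℂ]

variable {ε} {p : n.Partition}

theorem proj_eq_of_unit (hp : ∀ σ, chi p σ = (ε σ : ℤ)) :
    proj lam p = (n.factorial : ℂ)⁻¹ • intOp fun τ => (ε τ : ℤ) := by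
  rw [proj_eq p _ hp]
  simp

theorem mem_summand_iff (hp : ∀ σ, chi p σ = (ε σ : ℤ)) {x : Space n lam} :
    x ∈ summand lam p ↔ ∀ σ, permOp σ x = ((ε σ : ℤ) : ℂ) • x := by
  constructor
  · rintro ⟨y, rfl⟩ σ
    rw [ContinuousLinearMap.coe_coe, proj_eq_of_unit hp, smul_apply, map_smul,
      permOp_intOp_unit, smul_comm]
  · intro hx
    refine ⟨x, ?_⟩
    rw [ContinuousLinearMap.coe_coe, proj_eq_of_unit hp, smul_apply,
      intOp_unit_of_permOp ε hx, inv_smul_smul₀ (Nat.cast_ne_zero.2 n.factorial_ne_zero)]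

theorem proj_of_mem (hp : ∀ σ, chi p σ = (ε σ : ℤ)) {x : Space n lam} (hx : x ∈ summand lam p) :
    proj lam p x = x := by
  rw [proj_eq_of_unit hp, smul_apply, intOp_unit_of_permOp ε ((mem_summand_iff hp).1 hx),
    inv_smul_smul₀ (Nat.cast_ne_zero.2 n.factorial_ne_zero)]

theorem ofPoly_mem_summand (hp : ∀ σ, chi p σ = (ε σ : ℤ)) {d : MvPolynomial (Fin n) ℂ}
    (hd : ∀ σ : Equiv.Perm (Fin n), MvPolynomial.rename σ d = ((ε σ : ℤ) : ℂ) • d) :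
    (ofPoly d : Space n lam) ∈ summand lam p :=
  (mem_summand_iff hp).2 fun σ => by rw [permOp_ofPoly, hd, map_smul]

/-- The averaging can be done on polynomials, which allows identities on the summand to be checked
on equivariant polynomials. -/
theorem exists_proj_ofPoly (hp : ∀ σ, chi p σ = (ε σ : ℤ)) (q : MvPolynomial (Fin n) ℂ) :
    ∃ r : MvPolynomial (Fin n) ℂ,
    proj lam p (ofPoly q) = ofPoly r ∧
    ∀ σ : Equiv.Perm (Fin n), MvPolynomial.rename σ r = ((ε σ : ℤ) : ℂ) • r := by
  refine ⟨(n.factorial : ℂ)⁻¹ • ∑ τ, ((ε τ : ℤ) : ℂ) • MvPolynomial.rename τ q, ?_, fun σ => ?_⟩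
  · simp only [proj_eq_of_unit hp, smul_apply, intOp_apply, map_smul, map_sum, permOp_ofPoly]
  · simp only [map_smul, map_sum, MvPolynomial.rename_rename]
    rw [smul_comm]
    congr 1
    rw [Finset.smul_sum]
    refine Eq.trans ?_ (Equiv.sum_comp (Equiv.mulLeft σ) _)
    refine Finset.sum_congr rfl fun τ _ => ?_
    rw [smul_smul]
    congr 1
    rw [Equiv.coe_mulLeft, map_mul, Units.val_mul, Int.cast_mul, ← mul_assoc, ← Int.cast_mul,
      ← Units.val_mul, Int.units_mul_self]
    simp

theorem isSymmetric_mul {r s : MvPolynomial (Fin n) ℂ}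
    (hr : ∀ σ : Equiv.Perm (Fin n), MvPolynomial.rename σ r = ((ε σ : ℤ) : ℂ) • r)
    (hs : ∀ σ : Equiv.Perm (Fin n), MvPolynomial.rename σ s = ((ε σ : ℤ) : ℂ) • s) :
    (r * s).IsSymmetric := fun σ => by
  rw [map_mul, hr, hs, smul_mul_smul_comm, ← Int.cast_mul, ← Units.val_mul, Int.units_mul_self]
  simp

/-- A homomorphism of Hilbert modules out of the summand of a linear character is a
multiplication operator away from the zeros of a polynomial in the summand. -/
theorem apply_eq_of_intertwining (hp : ∀ σ, chi p σ = (ε σ : ℤ)) {q : n.Partition}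
    {d : MvPolynomial (Fin n) ℂ}
    (hd : ∀ σ : Equiv.Perm (Fin n), MvPolynomial.rename σ d = ((ε σ : ℤ) : ℂ) • d)
    (U : summand lam p →L[ℂ] summand lam q)
    (hU : ∀ (s : MvPolynomial.symmetricSubalgebra (Fin n) ℂ) f, U (s • f) = s • U f) :
    ∃ h : Space n lam, ∀ (f : summand lam p) (w : Polydisc n), MvPolynomial.eval w.1 d ≠ 0 →
      MvPolynomial.eval w.1 d * (U f : Space n lam) w = (f : Space n lam) w * h w := by
  let d' : summand lam p := ⟨ofPoly d, ofPoly_mem_summand hp hd⟩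
  refine ⟨U d', fun f w hw => ?_⟩
  let P : Space n lam →L[ℂ] summand lam p := (proj lam p).codRestrict _ fun x => ⟨x, rfl⟩
  have hP : P f = f := Subtype.ext (proj_of_mem hp f.2)
  let ev : Space n lam →L[ℂ] ℂ := innerSL ℂ (RKHS.kerFun (Space n lam) w 1)
  have hev : ∀ x, ev x = x w := fun x => inner_kerFun_one w x
  -- Both sides of $d(w)^2(Uf)(w)=d(w)(Ud)(w)f(w)$ are precomposed with the projection, giving
  -- continuous functionals on the whole space that need only be compared on monomials.
  let A : Space n lam →L[ℂ] ℂ := (MvPolynomial.eval w.1 (d * d)) •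
    (ev ∘L (summand lam q).subtypeL ∘L U ∘L P)
  let B : Space n lam →L[ℂ] ℂ := (MvPolynomial.eval w.1 d * (U d' : Space n lam) w) •
    (ev ∘L (summand lam p).subtypeL ∘L P)
  have hAB : A = B := ext_mon fun a => by
    obtain ⟨r, h1, h2⟩ := exists_proj_ofPoly (lam := lam) hp (mon a)
    have hPr : P (ofPoly (mon a)) = ⟨ofPoly r, ofPoly_mem_summand hp h2⟩ := Subtype.ext h1
    let s1 : MvPolynomial.symmetricSubalgebra (Fin n) ℂ := ⟨d * d, isSymmetric_mul hd hd⟩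
    let s2 : MvPolynomial.symmetricSubalgebra (Fin n) ℂ := ⟨r * d, isSymmetric_mul h2 hd⟩
    have hs : s1 • (⟨ofPoly r, ofPoly_mem_summand hp h2⟩ : summand lam p) = s2 • d' :=
      Subtype.ext (RKHS.ext fun z => by
        rw [smul_summand_apply, smul_summand_apply]
        simp only [s1, s2, d', ofPoly_apply, map_mul]
        ring)
    have h3 := congrArg (fun x : summand lam q => (x : Space n lam) w) (congrArg U hs)
    simp only [hU, smul_summand_apply] at h3
    have hA : A (ofPoly (mon a)) = MvPolynomial.eval w.1 (d * d) *
        (U (P (ofPoly (mon a))) : Space n lam) w := by rw [← hev]; rfl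
    have hB : B (ofPoly (mon a)) = MvPolynomial.eval w.1 d * (U d' : Space n lam) w *
        (P (ofPoly (mon a)) : Space n lam) w := by rw [← hev ((P (ofPoly (mon a)) : Space n lam))]; rfl
    rw [hA, hB, hPr, h3, ofPoly_apply]
    simp only [s2, map_mul]
    ring
  have h4 := congrArg (fun T : Space n lam →L[ℂ] ℂ => T f) hAB
  have hA : A f = MvPolynomial.eval w.1 (d * d) * (U (P f) : Space n lam) w := by
    rw [← hev]; rfl
  have hB : B f = MvPolynomial.eval w.1 d * (U d' : Space n lam) w * (P f : Space n lam) w := by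
    rw [← hev (P f : Space n lam)]; rfl
  simp only [hA, hB, hP, map_mul] at h4
  refine mul_left_cancel₀ hw ?_
  linear_combination h4

end LinearCharacter

variable {n : ℕ} {lam : ℝ} [Fact (0 < lam)]

/-! ### Rank: a linear character against the two-dimensional representation -/

theorem proj_part21_X (i : Fin 3) (z : Polydisc 3) :
    proj lam part21 (ofPoly (MvPolynomial.X i)) z = z.1 i - (z.1 0 + z.1 1 + z.1 2) / 3 := by
  -- This matrix is $3I-J$, with $J$ the all-ones matrix; after the factor $2/6$ the projection
  -- subtracts the mean of the coordinates.
  have hc : ∀ i j : Fin 3, (∑ σ : Equiv.Perm (Fin 3), if σ i = j then stdChar σ else 0) =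
      if i = j then 2 else -1 := by decide +kernel
  have h1 : (stdChar 1 : ℤ) = 2 := by decide +kernel
  have h2 : (intOp stdChar (ofPoly (MvPolynomial.X i)) : Space 3 lam) z =
      ∑ j, ((if i = j then 2 else -1 : ℤ) : ℂ) * z.1 j := by
    have h3 : (intOp stdChar (ofPoly (MvPolynomial.X i)) : Space 3 lam) =
        ofPoly (∑ σ : Equiv.Perm (Fin 3), (stdChar σ : ℂ) • MvPolynomial.X (σ i)) := by
      simp only [intOp_apply, permOp_ofPoly, MvPolynomial.rename_X, map_sum, map_smul]
    rw [h3, ofPoly_apply]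
    simp only [map_sum, MvPolynomial.smul_eval, MvPolynomial.eval_X, ← hc, Int.cast_sum,
      Finset.sum_mul]
    rw [Finset.sum_comm]
    refine Finset.sum_congr rfl fun σ _ => ?_
    rw [Finset.sum_eq_single (σ i)]
    · simp
    · intro j _ hj
      simp [hj.symm]
    · simp
  rw [proj_eq _ _ chi_part21, smul_apply, RKHS.coe_smul, Pi.smul_apply, h2, h1]
  fin_cases i <;> simp [Fin.sum_univ_three, Nat.factorial] <;> ring

theorem not_equiv_part21 {p : Nat.Partition 3} {ε : Equiv.Perm (Fin 3) →* ℤˣ}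
    (hp : ∀ σ, chi p σ = (ε σ : ℤ)) {d : MvPolynomial (Fin 3) ℂ}
    (hd : ∀ σ : Equiv.Perm (Fin 3), MvPolynomial.rename σ d = ((ε σ : ℤ) : ℂ) • d)
    (hd0 : MvPolynomial.eval ![0, 1 / 2, -1 / 2] d ≠ 0) :
    ¬ UnitarilyEquivalent (MvPolynomial.symmetricSubalgebra (Fin 3) ℂ)
      (summand lam p) (summand lam part21) := by
  rintro ⟨U, hU⟩
  obtain ⟨h, hh⟩ := apply_eq_of_intertwining hp hd
    (U.toContinuousLinearEquiv : summand lam p →L[ℂ] summand lam part21) hU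
  -- The coordinates sum to $0$, so the projected coordinate functions keep their values; at $w$ and
  -- its swap these are $(0,1/2)$ for the first and $(1/2,0)$ for the second.
  let w : Polydisc 3 := ⟨![0, 1 / 2, -1 / 2], fun i => by fin_cases i <;> norm_num⟩
  let τ : Equiv.Perm (Fin 3) := Equiv.swap 0 1
  let w' : Polydisc 3 := permPoint τ⁻¹ w
  have hw' : w'.1 = ![1 / 2, 0, -1 / 2] := by
    funext i
    fin_cases i <;> simp [w', w, permPoint, τ, Equiv.swap_apply_of_ne_of_ne]
  have hε : ((ε τ : ℤ) : ℂ) ≠ 0 := by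
    rcases Int.units_eq_one_or (ε τ) with h | h <;> simp [h]
  have htr : ∀ x : Space 3 lam, x ∈ summand lam p → x w' = ((ε τ : ℤ) : ℂ) * x w :=
    fun x hx => by
      rw [← permOp_apply, (mem_summand_iff hp).1 hx, RKHS.coe_smul, Pi.smul_apply, smul_eq_mul]
  have hdw : MvPolynomial.eval w'.1 d = ((ε τ : ℤ) : ℂ) * MvPolynomial.eval w.1 d := by
    rw [← ofPoly_apply (lam := lam), htr _ (ofPoly_mem_summand hp hd), ofPoly_apply]
  have hdw' : MvPolynomial.eval w'.1 d ≠ 0 := by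
    rw [hdw]
    exact mul_ne_zero hε hd0
  let F : Fin 3 → summand lam part21 := fun i =>
    ⟨proj lam part21 (ofPoly (MvPolynomial.X i)), ⟨_, rfl⟩⟩
  have key : ∀ i, MvPolynomial.eval w.1 d * (F i : Space 3 lam) w =
        (U.symm (F i) : Space 3 lam) w * h w ∧
      MvPolynomial.eval w.1 d * (F i : Space 3 lam) w' =
        (U.symm (F i) : Space 3 lam) w * h w' := fun i => by
    have h1 := hh (U.symm (F i)) w hd0
    have h2 := hh (U.symm (F i)) w' hdw'
    have h3 : (U.toContinuousLinearEquiv : summand lam p →L[ℂ] summand lam part21)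
        (U.symm (F i)) = F i := U.apply_symm_apply _
    rw [h3] at h1 h2
    refine ⟨h1, mul_left_cancel₀ hε ?_⟩
    rw [hdw, htr _ (U.symm (F i)).2] at h2
    linear_combination h2
  have hval : ∀ i z, (F i : Space 3 lam) z = z.1 i - (z.1 0 + z.1 1 + z.1 2) / 3 :=
    fun i z => proj_part21_X i z
  obtain ⟨h0, h0'⟩ := key 0
  obtain ⟨h1, h1'⟩ := key 1
  have v0 : (F 0 : Space 3 lam) w = 0 := by rw [hval]; simp [w]; norm_num
  have v0' : (F 0 : Space 3 lam) w' = 1 / 2 := by rw [hval, hw']; simp; norm_num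
  have v1 : (F 1 : Space 3 lam) w = 1 / 2 := by rw [hval]; simp [w]; norm_num
  have v1' : (F 1 : Space 3 lam) w' = 0 := by rw [hval, hw']; simp; norm_num
  rw [v0, mul_zero] at h0
  rw [v0'] at h0'
  rw [v1] at h1
  rw [v1', mul_zero] at h1'
  -- The $2\times2$ determinant of values vanishes, since both rows are multiples of $(h(w),h(w'))$.
  have h2 : (MvPolynomial.eval w.1 d * (1 / 2)) * (MvPolynomial.eval w.1 d * (1 / 2)) = 0 := by
    linear_combination MvPolynomial.eval w.1 d * (1 / 2) * h0' +
      (U.symm (F 0) : Space 3 lam) w * h w' * h1 - (U.symm (F 1) : Space 3 lam) w * h w' * h0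
  have h3 : MvPolynomial.eval w.1 d * (1 / 2) ≠ 0 := mul_ne_zero hd0 (by norm_num)
  exact mul_ne_zero h3 h3 h2

/-! ### Self-adjointness of the projections and the Vandermonde polynomial -/

theorem inner_proj_of_mem {ε : Equiv.Perm (Fin n) →* ℤˣ} {p : n.Partition}
    (hp : ∀ σ, chi p σ = (ε σ : ℤ)) {x : Space n lam} (hx : x ∈ summand lam p) (y : Space n lam) :
    inner ℂ x (proj lam p y) = inner ℂ x y := by
  have h := inner_intOp (fun σ => (ε σ : ℤ)) x y
  simp only [map_inv, Int.units_inv_eq_self] at h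
  rw [proj_eq_of_unit hp, smul_apply, inner_smul_right, ← h,
    intOp_unit_of_permOp ε ((mem_summand_iff hp).1 hx), inner_smul_left, map_natCast,
    inv_mul_cancel_left₀ (Nat.cast_ne_zero.2 n.factorial_ne_zero)]

/-- The Vandermonde polynomial in three variables. -/
def vandermondePoly : MvPolynomial (Fin 3) ℂ := (Matrix.vandermonde MvPolynomial.X).det

theorem rename_vandermondePoly (σ : Equiv.Perm (Fin 3)) :
    MvPolynomial.rename σ vandermondePoly =
      ((Equiv.Perm.sign σ : ℤ) : ℂ) • vandermondePoly := by
  rw [vandermondePoly, AlgHom.map_det, MvPolynomial.smul_eq_C_mul, map_intCast,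
    ← Matrix.det_permute]
  congr 1
  ext1 i j
  simp [Matrix.vandermonde_apply]

theorem eval_vandermondePoly_ne_zero :
    MvPolynomial.eval ![0, 1 / 2, -1 / 2] vandermondePoly ≠ 0 := by
  simp [vandermondePoly, Matrix.det_fin_three, Matrix.vandermonde_apply]
  norm_num

/-! ### The trivial character against the sign character -/

/-- The adjoint of multiplication by $z^b$ sends $z^a$ to a multiple of $z^{a-b}$, or to $0$ when
$b\not\le a$. -/
theorem inner_mon_mulPoly {a : Fin n → ℕ} (b : Fin n → ℕ) (f : Space n lam)
    (h : ∀ c ≤ a, c + b = a → inner ℂ (ofPoly (mon c) : Space n lam) f = 0) :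
    inner ℂ (ofPoly (mon a) : Space n lam) (mulPoly (mon b) f) = 0 := by
  have hl : 0 < lam := Fact.out
  let A : Space n lam →L[ℂ] ℂ := innerSL ℂ (ofPoly (mon a) : Space n lam) ∘L mulPoly (mon b)
  by_cases hba : b ≤ a
  · let c : Fin n → ℕ := a - b
    have hc : c + b = a := tsub_add_cancel_of_le hba
    let B : Space n lam →L[ℂ] ℂ := ((kerCoeff lam c : ℂ) * (kerCoeff lam a : ℂ)⁻¹) •
      innerSL ℂ (ofPoly (mon c) : Space n lam)
    have hAB : A = B := ext_mon fun e => by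
      change inner ℂ (ofPoly (mon a) : Space n lam) (mulPoly (mon b) (ofPoly (mon e))) =
        ((kerCoeff lam c : ℂ) * (kerCoeff lam a : ℂ)⁻¹) *
          inner ℂ (ofPoly (mon c) : Space n lam) (ofPoly (mon e))
      rw [mulPoly_ofPoly, ← mon_add]
      by_cases he : e = c
      · rw [he, add_comm b c, hc, inner_mon_self, inner_mon_self, mul_right_comm,
          mul_inv_cancel₀ (Complex.ofReal_ne_zero.2 (kerCoeff_pos hl c).ne'), one_mul]
      · rw [inner_mon_of_ne (Ne.symm he), inner_mon_of_ne, mul_zero]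
        rintro rfl
        exact he (add_left_cancel (a := b) (by rw [add_comm b c, hc]))
    change A f = 0
    rw [hAB]
    change ((kerCoeff lam c : ℂ) * (kerCoeff lam a : ℂ)⁻¹) * inner ℂ _ f = 0
    rw [h c (hc ▸ le_self_add) hc, mul_zero]
  · have hA : A = 0 := ext_mon fun e => by
      change inner ℂ (ofPoly (mon a) : Space n lam) (mulPoly (mon b) (ofPoly (mon e))) = (0 : ℂ)
      rw [mulPoly_ofPoly, ← mon_add]
      refine inner_mon_of_ne ?_
      rintro rfl
      exact hba le_self_add
    change A f = 0
    rw [hA]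
    rfl

/-- Antisymmetric elements of the Bergman space. -/
def IsAlt (f : Space n lam) : Prop :=
  ∀ σ, permOp σ f = ((Equiv.Perm.sign σ : ℤ) : ℂ) • f

/-- A transposition of two equal exponents fixes the monomial and negates $f$. -/
theorem IsAlt.inner_eq_zero {f : Space n lam} (hf : IsAlt f) {c : Fin n → ℕ}
    (hc : ¬ Function.Injective c) : inner ℂ (ofPoly (mon c)) f = 0 := by
  obtain ⟨i, j, hij, hne⟩ := Function.not_injective_iff.1 hc
  have h1 : permOp (Equiv.swap i j) (ofPoly (mon c) : Space n lam) = ofPoly (mon c) := by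
    rw [permOp_ofPoly, rename_mon]
    congr 2
    funext k
    simp only [Equiv.symm_swap, Function.comp_apply, Equiv.swap_apply_def]
    split_ifs with h h' <;> simp [*]
  have h2 := inner_permOp (Equiv.swap i j) (ofPoly (mon c)) f
  rw [h1, Equiv.swap_inv, hf, Equiv.Perm.sign_swap hne, inner_smul_right] at h2
  simpa [self_eq_neg] using h2

/-- The antisymmetrization of a monomial. -/
def altMon (a : Fin n → ℕ) : Space n lam :=
  intOp (fun σ => (Equiv.Perm.sign σ : ℤ)) (ofPoly (mon a))

theorem isAlt_altMon (a : Fin n → ℕ) : IsAlt (altMon a : Space n lam) :=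
  fun σ => permOp_intOp_unit Equiv.Perm.sign σ _

theorem IsAlt.inner_altMon {f : Space n lam} (hf : IsAlt f) (a : Fin n → ℕ) :
    inner ℂ (altMon a) f = n.factorial * inner ℂ (ofPoly (mon a)) f := by
  rw [altMon, inner_intOp, ← inner_smul_right, ← intOp_unit_of_permOp Equiv.Perm.sign hf]
  simp only [Equiv.Perm.sign_inv]

theorem altMon_eq_zero {a : Fin n → ℕ} (ha : ¬ Function.Injective a) :
    (altMon a : Space n lam) = 0 := by
  rw [← inner_self_eq_zero (𝕜 := ℂ), (isAlt_altMon a).inner_altMon,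
    (isAlt_altMon a).inner_eq_zero ha, mul_zero]

/-- Nontrivial permutations of an injective exponent give different, hence orthogonal, monomials;
only the identity contributes. -/
theorem inner_altMon_self {a : Fin n → ℕ} (ha : Function.Injective a) :
    inner ℂ (altMon a : Space n lam) (altMon a) = n.factorial * (kerCoeff lam a : ℂ)⁻¹ := by
  rw [(isAlt_altMon a).inner_altMon, altMon, intOp_apply, inner_sum,
    Finset.sum_eq_single 1 ?_ (by simp)]
  · rw [permOp_one, inner_smul_right, inner_mon_self]
    simp
  · intro σ _ hσ
    rw [inner_smul_right, permOp_ofPoly, rename_mon, inner_mon_of_ne, mul_zero]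
    intro h
    refine hσ (inv_eq_one.1 (Equiv.ext fun i => ha (congrFun h i).symm))

/-- On antisymmetric functions, the functional given by the monomial of the Vandermonde
determinant is a joint eigenvector of the adjoint multiplication operators. -/
theorem IsAlt.inner_mulPoly {f : Space 3 lam} (hf : IsAlt f) (s : MvPolynomial (Fin 3) ℂ) :
    inner ℂ (ofPoly (mon ![2, 1, 0])) (mulPoly s f) =
      MvPolynomial.eval 0 s * inner ℂ (ofPoly (mon ![2, 1, 0])) f := by
  have hs : s ∈ Submodule.span ℂ (Set.range (mon (n := 3))) := span_range_mon ▸ Submodule.mem_top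
  induction hs using Submodule.span_induction with
  | mem x hx =>
    obtain ⟨b, rfl⟩ := hx
    by_cases hb : b = 0
    · simp [hb, mon_zero]
    · have h0 : MvPolynomial.eval 0 (mon b) = 0 := by
        obtain ⟨i, hi⟩ := Function.ne_iff.1 hb
        rw [eval_mon]
        exact Finset.prod_eq_zero (Finset.mem_univ i) (by simpa using hi)
      rw [h0, zero_mul]
      -- An exponent with distinct entries below $(2,1,0)$ must be $(2,1,0)$ itself, which would
      -- force $b=0$.
      refine inner_mon_mulPoly b f fun c _ hc => hf.inner_eq_zero fun hinj => hb ?_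
      have e0 : c 0 + b 0 = 2 := congrFun hc 0
      have e1 : c 1 + b 1 = 1 := congrFun hc 1
      have e2 : c 2 + b 2 = 0 := congrFun hc 2
      have n01 : c 0 ≠ c 1 := hinj.ne (by decide)
      have n02 : c 0 ≠ c 2 := hinj.ne (by decide)
      have n12 : c 1 ≠ c 2 := hinj.ne (by decide)
      funext i
      fin_cases i <;> simp <;> omega
  | zero => simp
  | add x y _ _ hx hy => simp [hx, hy, add_mul]
  | smul c x _ hx => simp [hx, mul_assoc]

/-! ### Multiplication by the first elementary symmetric polynomial and comparison of norms -/

theorem inner_one_left (f : Space n lam) : inner ℂ 1 f = f ⟨0, by simp⟩ :=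
  inner_kerFun_one _ f

theorem sum_X_isSymmetric : (∑ i : Fin n, MvPolynomial.X i : MvPolynomial (Fin n) ℂ).IsSymmetric :=
  fun σ => by
    simp only [map_sum, MvPolynomial.rename_X]
    exact Equiv.sum_comp σ _

/-- Multiplication by a symmetric polynomial commutes with antisymmetrization, and the exponents
$(2,2,0)$ and $(2,1,1)$ have a repeated entry. -/
theorem mulPoly_sum_X_altMon :
    mulPoly (∑ i : Fin 3, MvPolynomial.X i) (altMon ![2, 1, 0] : Space 3 lam) =
      altMon ![3, 1, 0] := by
  have h1 : mulPoly (∑ i : Fin 3, MvPolynomial.X i) (altMon ![2, 1, 0] : Space 3 lam) =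
      altMon ![3, 1, 0] + altMon ![2, 2, 0] + altMon ![2, 1, 1] := by
    have h2 : (∑ i : Fin 3, MvPolynomial.X i) * mon ![2, 1, 0] =
        mon ![3, 1, 0] + mon ![2, 2, 0] + mon ![2, 1, 1] := by
      simp only [mon, Fin.sum_univ_three, Fin.prod_univ_three]
      simp
      ring
    simp only [altMon, ← map_add, ← h2, ← mulPoly_ofPoly]
    rw [intOp_apply, intOp_apply, map_sum]
    exact Finset.sum_congr rfl fun σ _ => by rw [map_smul, mulPoly_permOp sum_X_isSymmetric]
  rw [h1, altMon_eq_zero (a := ![2, 2, 0]) (by decide),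
    altMon_eq_zero (a := ![2, 1, 1]) (by decide), add_zero, add_zero]

theorem X_eq_mon (i : Fin n) :
    (MvPolynomial.X i : MvPolynomial (Fin n) ℂ) = mon (Pi.single i 1) := by
  rw [mon, Finset.prod_eq_single i (fun j _ hj => by simp [hj]) (by simp)]
  simp

theorem inner_sum_X : inner ℂ (ofPoly (∑ i : Fin n, MvPolynomial.X i) : Space n lam)
    (ofPoly (∑ i : Fin n, MvPolynomial.X i)) = n * (lam : ℂ)⁻¹ := by
  have h : ∀ i : Fin n, kerCoeff lam (Pi.single i 1) = lam := fun i => by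
    rw [kerCoeff, Finset.prod_eq_single i (fun j _ hj => by simp [hj, binomCoeff]) (by simp)]
    simp [binomCoeff]
  have h2 : ∀ i j : Fin n, inner ℂ (ofPoly (mon (Pi.single i 1)) : Space n lam)
      (ofPoly (mon (Pi.single j 1))) = if i = j then (lam : ℂ)⁻¹ else 0 := fun i j => by
    split_ifs with hij
    · rw [hij, inner_mon_self, h]
    · refine inner_mon_of_ne fun h => hij ?_
      by_contra hne
      simpa [hne] using congrFun h i
  simp only [X_eq_mon, map_sum, sum_inner, inner_sum, h2]
  simp

theorem not_equiv_part3_part111 :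
    ¬ UnitarilyEquivalent (MvPolynomial.symmetricSubalgebra (Fin 3) ℂ)
      (summand lam part3) (summand lam part111) := by
  rintro ⟨U, hU⟩
  have hl : 0 < lam := Fact.out
  have hp3 : ∀ σ, chi part3 σ = ((1 : Equiv.Perm (Fin 3) →* ℤˣ) σ : ℤ) := fun σ => by
    rw [chi_part3]
    rfl
  have hone : (1 : Space 3 lam) ∈ summand lam part3 := by
    rw [← ofPoly_one]
    exact ofPoly_mem_summand hp3 fun σ => by simp
  let one : summand lam part3 := ⟨1, hone⟩
  let Δ : summand lam part111 :=
    ⟨altMon ![2, 1, 0], (mem_summand_iff chi_part111).2 (isAlt_altMon _)⟩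
  have halt : ∀ f : summand lam part111, IsAlt (f : Space 3 lam) := fun f =>
    (mem_summand_iff chi_part111).1 f.2
  let g : summand lam part3 := U.symm Δ
  have hg : ∀ s : MvPolynomial.symmetricSubalgebra (Fin 3) ℂ,
      inner ℂ g (s • one) = MvPolynomial.eval 0 (s : MvPolynomial (Fin 3) ℂ) * inner ℂ g one := by
    intro s
    have h1 : ∀ x, inner ℂ g x = inner ℂ (altMon ![2, 1, 0] : Space 3 lam) (U x) := fun x => by
      rw [← U.inner_map_map, U.apply_symm_apply]
      rfl
    rw [h1, h1, hU, (halt _).inner_altMon, (halt _).inner_altMon]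
    have h2 : ((s • U one : summand lam part111) : Space 3 lam) =
        mulPoly (s : MvPolynomial (Fin 3) ℂ) (U one : Space 3 lam) := rfl
    rw [h2, (halt _).inner_mulPoly]
    ring
  -- With this coefficient, $g-c\cdot1$ is orthogonal to every symmetric polynomial, because pairing
  -- with $g$ or with $1$ only sees the value at $0$. By density it vanishes.
  let c : ℂ := inner ℂ one g
  have hgc : (g : Space 3 lam) = c • 1 := by
    rw [← sub_eq_zero]
    set x : Space 3 lam := g - c • 1 with hx
    have hxm : x ∈ summand lam part3 := Submodule.sub_mem _ g.2 (Submodule.smul_mem _ _ hone)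
    have hT : innerSL ℂ x = 0 := ext_mon fun a => by
      obtain ⟨r, hr1, hr2⟩ := exists_proj_ofPoly (lam := lam) hp3 (mon a)
      have hsym : r.IsSymmetric := fun σ => by simpa using hr2 σ
      have h1 : inner ℂ x (ofPoly (mon a)) = inner ℂ x (ofPoly r : Space 3 lam) := by
        rw [← hr1, inner_proj_of_mem hp3 hxm]
      have h2 := hg ⟨r, hsym⟩
      have h3 : inner ℂ (g : Space 3 lam) (ofPoly r) =
        MvPolynomial.eval 0 r * inner ℂ (g : Space 3 lam) 1 := h2
      change inner ℂ x _ = (0 : ℂ)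
      rw [h1, hx, inner_sub_left, inner_smul_left, inner_one_left, ofPoly_apply, h3]
      have h4 : conj c = inner ℂ (g : Space 3 lam) 1 := inner_conj_symm _ _
      rw [h4]
      ring
    rw [← inner_self_eq_zero (𝕜 := ℂ)]
    exact congrArg (fun T : Space 3 lam →L[ℂ] ℂ => T x) hT
  let e : MvPolynomial.symmetricSubalgebra (Fin 3) ℂ := ⟨_, sum_X_isSymmetric⟩
  have hUg : U g = Δ := U.apply_symm_apply _
  have hN1 : inner ℂ (g : Space 3 lam) (g : Space 3 lam) =
      inner ℂ (altMon ![2, 1, 0] : Space 3 lam) (altMon ![2, 1, 0]) := by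
    have h := U.inner_map_map g g
    rw [hUg] at h
    exact h.symm
  have hN2 : inner ℂ (mulPoly (∑ i : Fin 3, MvPolynomial.X i) (g : Space 3 lam))
      (mulPoly (∑ i : Fin 3, MvPolynomial.X i) (g : Space 3 lam)) =
      inner ℂ (altMon ![3, 1, 0] : Space 3 lam) (altMon ![3, 1, 0]) := by
    have h := U.inner_map_map (e • g) (e • g)
    rw [hU, hUg] at h
    rw [← mulPoly_sum_X_altMon]
    exact h.symm
  have h11 : inner ℂ (1 : Space 3 lam) 1 = (1 : ℂ) := by rw [inner_one_left, one_apply]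
  rw [hgc, inner_smul_left, inner_smul_right, h11, inner_altMon_self (by decide)] at hN1
  rw [hgc, map_smul, inner_smul_left, inner_smul_right, ← ofPoly_one, mulPoly_ofPoly, mul_one,
    inner_sum_X, inner_altMon_self (by decide)] at hN2
  have hk1 : kerCoeff lam ![2, 1, 0] = lam * (lam + 1) / 2 * lam := by
    simp [kerCoeff, Fin.prod_univ_three, binomCoeff]
    norm_num
  have hk2 : kerCoeff lam ![3, 1, 0] = lam * (lam + 1) / 2 * (lam + 2) / 3 * lam := by
    simp [kerCoeff, Fin.prod_univ_three, binomCoeff]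
    norm_num
  rw [hk1, mul_one] at hN1
  rw [hk2, ← mul_assoc, hN1] at hN2
  -- After cancelling $\|\Delta\|^2$ this reads $3/\lambda=3/(\lambda+2)$.
  have hfin : (6 * (lam * (lam + 1) / 2 * lam)⁻¹) * (3 * lam⁻¹) =
      6 * (lam * (lam + 1) / 2 * (lam + 2) / 3 * lam)⁻¹ := by
    have := hN2
    simp only [Nat.factorial] at this
    exact_mod_cast this
  field_simp at hfin
  linarith

end Bergman

end

theorem corollary4p15 (lam : ℝ) [Fact (0 < lam)] :
    (Bergman.summand lam Bergman.part3 ⟂ Bergman.summand lam Bergman.part21 ∧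
      Bergman.summand lam Bergman.part3 ⟂ Bergman.summand lam Bergman.part111 ∧
      Bergman.summand lam Bergman.part21 ⟂ Bergman.summand lam Bergman.part111 ∧
      Bergman.summand lam Bergman.part3 ⊔ Bergman.summand lam Bergman.part21 ⊔
        Bergman.summand lam Bergman.part111 = ⊤) ∧
    ¬ Bergman.UnitarilyEquivalent (MvPolynomial.symmetricSubalgebra (Fin 3) ℂ)
        (Bergman.summand lam Bergman.part3) (Bergman.summand lam Bergman.part21) ∧
    ¬ Bergman.UnitarilyEquivalent (MvPolynomial.symmetricSubalgebra (Fin 3) ℂ)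
        (Bergman.summand lam Bergman.part3) (Bergman.summand lam Bergman.part111) ∧
    ¬ Bergman.UnitarilyEquivalent (MvPolynomial.symmetricSubalgebra (Fin 3) ℂ)
        (Bergman.summand lam Bergman.part21) (Bergman.summand lam Bergman.part111) := by
  refine ⟨⟨Bergman.summand_isOrtho Bergman.chi_part3 Bergman.chi_part21 (by decide +kernel),
    Bergman.summand_isOrtho Bergman.chi_part3 Bergman.chi_part111 (by decide +kernel),
    Bergman.summand_isOrtho Bergman.chi_part21 Bergman.chi_part111 (by decide +kernel),
    Bergman.summand_sup_eq_top⟩, ?_, Bergman.not_equiv_part3_part111, ?_⟩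
  · refine Bergman.not_equiv_part21 (ε := 1) (d := 1) (fun σ => ?_) (by simp) (by simp)
    rw [Bergman.chi_part3]
    rfl
  -- The rank obstruction is stated with the linear character as source, so the inverse unitary is
  -- used; the Vandermonde polynomial serves as $d$.
  · rintro ⟨U, hU⟩
    refine Bergman.not_equiv_part21 Bergman.chi_part111 Bergman.rename_vandermondePoly
      Bergman.eval_vandermondePoly_ne_zero ⟨U.symm, fun s f => ?_⟩
    rw [LinearIsometryEquiv.symm_apply_eq, hU, U.apply_symm_apply]
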